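/- Let $L>0$ and $\gamma\in\mathbb R$. Let $\mathcal G_L$ be the tadpole graph, consisting of a loop $c$ identified with $[-L,L]$ and a half-line $h$ identified with $[0,\infty)$, joined at one vertex $\mathrm v$, which corresponds to the points $\pm L$ of $c$ and to the point $0$ of $h$. Functions on $\mathcal G_L$ are pairs $v=(v_c,v_h)$ of complex-valued functions, with $L^2(\mathcal G_L)=L^2(-L,L)\oplus L^2(0,\infty)$ and $H^2(\mathcal G_L)=H^2(-L,L)\oplus H^2(0,\infty)$. Let $H_\gamma$ be the operator $H_\gamma v=(-v_c'',-v_h'')$ in $L^2(\mathcal G_L)$ with domain $$D(H_\gamma)=\{v\in H^2(\mathcal G_L): v_c(L)=v_c(-L)=v_h(0)=:v(\mathrm v),\ \ v_c'(-L)-v_c'(L)+v_h'(0)=\gamma v(\mathrm v)\}.$$ Write $\sigma(H_\gamma)\subset\mathbb C$ for its spectrum, $\sigma_{\mathrm{dis}}(H_\gamma)$ for the set of isolated points of $\sigma(H_\gamma)$ that are eigenvalues of finite multiplicity, and $\sigma_{\mathrm{ess}}(H_\gamma)=\sigma(H_\gamma)\setminus\sigma_{\mathrm{dis}}(H_\gamma)$.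 **Proposition.** The essential spectrum is $\sigma_{\mathrm{ess}}(H_\gamma)=[0,\infty)$. If $\gamma\ge 0$, then $\sigma_{\mathrm{dis}}(H_\gamma)=\emptyset$. If $\gamma<0$, then the equation $$-\sqrt{|\lambda|}\,\bigl(2\tanh(\sqrt{|\lambda|}\,L)+1\bigr)=\gamma$$ has exactly one negative solution $\lambda=\lambda_\gamma$, and $\sigma_{\mathrm{dis}}(H_\gamma)=\{\lambda_\gamma\}$. -/

import Mathlib

open MeasureTheory Set
open scoped ContDiff

noncomputable section

namespace Tadpole

/-! ### Spectral theory of unbounded operators -/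

section Spectral

variable {E : Type*} [NormedAddCommGroup E] [InnerProductSpace ℂ E]

/-- The resolvent set of an unbounded operator `T` with domain `T.domain ⊆ E`: those `z` for which
`T - z` maps the domain bijectively onto `E`, with an everywhere defined bounded inverse `R`. -/
def resolventSet (T : E →ₗ.[ℂ] E) : Set ℂ :=
  {z | ∃ R : E →L[ℂ] E,
    (∀ f : E, ∃ h : R f ∈ T.domain, T ⟨R f, h⟩ - z • R f = f) ∧
    (∀ v : T.domain, R (T v - z • (v : E)) = v)}

/-- The spectrum: the complement of the resolvent set in `ℂ`. -/
def spectrum (T : E →ₗ.[ℂ] E) : Set ℂ := (resolventSet T)ᶜ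

/-- The eigenspace `{v ∈ D(T) : T v = z v}`. -/
def eigenspace (T : E →ₗ.[ℂ] E) (z : ℂ) : Submodule ℂ T.domain :=
  LinearMap.ker (T.toFun - z • T.domain.subtype)

/-- The discrete spectrum of a self-adjoint operator: the eigenvalues of finite multiplicity which
are isolated points of the spectrum. -/
def discreteSpectrum (T : E →ₗ.[ℂ] E) : Set ℂ :=
  {z | (∃ ε > 0, spectrum T ∩ Metric.ball z ε = {z}) ∧
    eigenspace T z ≠ ⊥ ∧ FiniteDimensional ℂ (eigenspace T z)}

/-- The essential spectrum of a self-adjoint operator: the part of the spectrum which is not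
discrete. -/
def essentialSpectrum (T : E →ₗ.[ℂ] E) : Set ℂ := spectrum T \ discreteSpectrum T

end Spectral

/-! ### Sobolev functions on open subsets of the line -/

/-- `L²(U)`, complex valued. -/
abbrev L2 (U : Set ℝ) : Type := Lp ℂ 2 (volume.restrict U)

/-- `g` is the weak derivative of `f` on `U`, both in `L²(U)`. -/
def HasWeakDeriv (U : Set ℝ) (f g : L2 U) : Prop :=
  ∀ φ : ℝ → ℝ, ContDiff ℝ ∞ φ → HasCompactSupport φ → tsupport φ ⊆ U →
    ∫ x in U, deriv φ x • f x = - ∫ x in U, φ x • g x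

open Classical in
/-- The weak derivative of `f`, if `f` has one in `L²(U)` (it is then unique), and `0` otherwise. -/
def weakDeriv (U : Set ℝ) (f : L2 U) : L2 U :=
  if h : ∃ g, HasWeakDeriv U f g then h.choose else 0

/-- `f ∈ H²(U)`: the first and second weak derivatives exist and lie in `L²(U)`. -/
def MemH2 (U : Set ℝ) (f : L2 U) : Prop :=
  ∃ g k : L2 U, HasWeakDeriv U f g ∧ HasWeakDeriv U g k

/-- `f` takes the value `y` at the point `x` of the closure of `U`: it has a representative which
is continuous on the closure of `U` and takes the value `y` at `x`. For an interval `U`, every `f`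
in `H¹(U)` has exactly one such representative, hence exactly one value at each `x`. -/
def HasTrace (U : Set ℝ) (f : L2 U) (x : ℝ) (y : ℂ) : Prop :=
  ∃ u : ℝ → ℂ, ContinuousOn u (closure U) ∧ f =ᵐ[volume.restrict U] u ∧ u x = y

section Linear

variable {U : Set ℝ} {f f' g g' : L2 U}

lemma L2.integrable_smul (f : L2 U) {φ : ℝ → ℝ} (hφ : Continuous φ) (hc : HasCompactSupport φ) :
    Integrable (fun x => φ x • f x) (volume.restrict U) :=
  ((Lp.memLp f).locallyIntegrable (by norm_num)).integrable_smul_left_of_hasCompactSupport hφ hc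

lemma HasWeakDeriv.add (hf : HasWeakDeriv U f f') (hg : HasWeakDeriv U g g') :
    HasWeakDeriv U (f + g) (f' + g') := by
  intro φ h1 h2 h3
  have hd : Continuous (deriv φ) := h1.continuous_deriv (by simp)
  have e1 : ∫ x in U, deriv φ x • (f + g) x = ∫ x in U, (deriv φ x • f x + deriv φ x • g x) := by
    refine integral_congr_ae ?_
    filter_upwards [Lp.coeFn_add f g] with x hx
    rw [hx, Pi.add_apply, smul_add]
  have e2 : ∫ x in U, φ x • (f' + g') x = ∫ x in U, (φ x • f' x + φ x • g' x) := by
    refine integral_congr_ae ?_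
    filter_upwards [Lp.coeFn_add f' g'] with x hx
    rw [hx, Pi.add_apply, smul_add]
  rw [e1, e2, integral_add (f.integrable_smul hd h2.deriv) (g.integrable_smul hd h2.deriv),
    integral_add (f'.integrable_smul h1.continuous h2) (g'.integrable_smul h1.continuous h2),
    hf φ h1 h2 h3, hg φ h1 h2 h3, neg_add]

lemma HasWeakDeriv.smul (c : ℂ) (hf : HasWeakDeriv U f f') :
    HasWeakDeriv U (c • f) (c • f') := by
  intro φ h1 h2 h3
  have e1 : ∫ x in U, deriv φ x • (c • f) x = ∫ x in U, c • (deriv φ x • f x) := by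
    refine integral_congr_ae ?_
    filter_upwards [Lp.coeFn_smul c f] with x hx
    rw [hx, Pi.smul_apply, smul_comm]
  have e2 : ∫ x in U, φ x • (c • f') x = ∫ x in U, c • (φ x • f' x) := by
    refine integral_congr_ae ?_
    filter_upwards [Lp.coeFn_smul c f'] with x hx
    rw [hx, Pi.smul_apply, smul_comm]
  rw [e1, e2, integral_smul, integral_smul, hf φ h1 h2 h3, smul_neg]

lemma HasWeakDeriv.zero : HasWeakDeriv U 0 0 := by
  intro φ _ _ _
  have e (ψ : ℝ → ℝ) : ∫ x in U, ψ x • (0 : L2 U) x = 0 := by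
    rw [← integral_zero ℝ ℂ]
    refine integral_congr_ae ?_
    filter_upwards [Lp.coeFn_zero ℂ 2 (volume.restrict U)] with x hx
    rw [hx, Pi.zero_apply, smul_zero]
  rw [e, e, neg_zero]

lemma HasWeakDeriv.unique (hU : IsOpen U) (h : HasWeakDeriv U f g) (h' : HasWeakDeriv U f g') :
    g = g' := by
  have hli : LocallyIntegrable (g - g' : L2 U) (volume.restrict U) :=
    (Lp.memLp (g - g')).locallyIntegrable (by norm_num)
  have key := hU.ae_eq_zero_of_integral_contDiff_smul_eq_zero (hli.locallyIntegrableOn U)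
    (fun φ h1 h2 h3 => by
      have e : ∫ x in U, φ x • (g - g' : L2 U) x = ∫ x in U, (φ x • g x - φ x • g' x) := by
        refine integral_congr_ae ?_
        filter_upwards [Lp.coeFn_sub g g'] with x hx
        rw [hx, Pi.sub_apply, smul_sub]
      have e' := (h φ h1 h2 h3).symm.trans (h' φ h1 h2 h3)
      rw [e, integral_sub (g.integrable_smul h1.continuous h2)
        (g'.integrable_smul h1.continuous h2), neg_injective e', sub_self])
  refine sub_eq_zero.1 (Lp.ext ?_)
  filter_upwards [key, ae_restrict_mem hU.measurableSet, Lp.coeFn_zero ℂ 2 (volume.restrict U)]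
    with x hx hxU h0
  rw [hx hxU, h0, Pi.zero_apply]

lemma HasWeakDeriv.weakDeriv_eq (hU : IsOpen U) (h : HasWeakDeriv U f g) :
    weakDeriv U f = g := by
  have hex : ∃ g, HasWeakDeriv U f g := ⟨g, h⟩
  rw [weakDeriv, dif_pos hex]
  exact hex.choose_spec.unique hU h

lemma weakDeriv_zero (hU : IsOpen U) : weakDeriv U 0 = 0 := HasWeakDeriv.zero.weakDeriv_eq hU

lemma MemH2.add (hf : MemH2 U f) (hg : MemH2 U g) : MemH2 U (f + g) := by
  obtain ⟨a, b, h1, h2⟩ := hf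
  obtain ⟨c, d, h3, h4⟩ := hg
  exact ⟨a + c, b + d, h1.add h3, h2.add h4⟩

lemma MemH2.smul (c : ℂ) (hf : MemH2 U f) : MemH2 U (c • f) := by
  obtain ⟨a, b, h1, h2⟩ := hf
  exact ⟨c • a, c • b, h1.smul c, h2.smul c⟩

lemma MemH2.weakDeriv_add (hU : IsOpen U) (hf : MemH2 U f) (hg : MemH2 U g) :
    weakDeriv U (f + g) = weakDeriv U f + weakDeriv U g := by
  obtain ⟨a, b, h1, h2⟩ := hf
  obtain ⟨c, d, h3, h4⟩ := hg
  rw [(h1.add h3).weakDeriv_eq hU, h1.weakDeriv_eq hU, h3.weakDeriv_eq hU]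

lemma MemH2.weakDeriv_smul (hU : IsOpen U) (c : ℂ) (hf : MemH2 U f) :
    weakDeriv U (c • f) = c • weakDeriv U f := by
  obtain ⟨a, b, h1, h2⟩ := hf
  rw [(h1.smul c).weakDeriv_eq hU, h1.weakDeriv_eq hU]

lemma MemH2.weakDeriv2_add (hU : IsOpen U) (hf : MemH2 U f) (hg : MemH2 U g) :
    weakDeriv U (weakDeriv U (f + g)) =
      weakDeriv U (weakDeriv U f) + weakDeriv U (weakDeriv U g) := by
  obtain ⟨a, b, h1, h2⟩ := hf
  obtain ⟨c, d, h3, h4⟩ := hg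
  rw [(h1.add h3).weakDeriv_eq hU, h1.weakDeriv_eq hU, h3.weakDeriv_eq hU,
    (h2.add h4).weakDeriv_eq hU, h2.weakDeriv_eq hU, h4.weakDeriv_eq hU]

lemma MemH2.weakDeriv2_smul (hU : IsOpen U) (c : ℂ) (hf : MemH2 U f) :
    weakDeriv U (weakDeriv U (c • f)) = c • weakDeriv U (weakDeriv U f) := by
  obtain ⟨a, b, h1, h2⟩ := hf
  rw [(h1.smul c).weakDeriv_eq hU, h1.weakDeriv_eq hU, (h2.smul c).weakDeriv_eq hU,
    h2.weakDeriv_eq hU]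

lemma HasTrace.add {x : ℝ} {y z : ℂ} (hf : HasTrace U f x y) (hg : HasTrace U g x z) :
    HasTrace U (f + g) x (y + z) := by
  obtain ⟨u, hu, hfu, rfl⟩ := hf
  obtain ⟨w, hw, hgw, rfl⟩ := hg
  exact ⟨u + w, hu.add hw, (Lp.coeFn_add f g).trans (hfu.add hgw), rfl⟩

lemma HasTrace.smul {x : ℝ} {y : ℂ} (c : ℂ) (hf : HasTrace U f x y) :
    HasTrace U (c • f) x (c • y) := by
  obtain ⟨u, hu, hfu, rfl⟩ := hf
  exact ⟨c • u, hu.const_smul c, (Lp.coeFn_smul c f).trans (hfu.const_smul c), rfl⟩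

lemma HasTrace.zero {x : ℝ} : HasTrace U 0 x 0 :=
  ⟨0, continuousOn_const, Lp.coeFn_zero _ _ _, rfl⟩

end Linear

/-! ### The tadpole graph and the Laplacian with a delta condition at its vertex -/

/-- The loop `c` (without the vertex), identified with `(-L, L)`. -/
abbrev loop (L : ℝ) : Set ℝ := Ioo (-L) L

/-- The tail `h` (without the vertex), identified with `(0, ∞)`. -/
abbrev tail : Set ℝ := Ioi 0

/-- The Hilbert space `L²(-L, L) ⊕ L²(0, ∞)` of functions `v = (v_c, v_h)` on the tadpole. -/
abbrev L2Tadpole (L : ℝ) : Type := WithLp 2 (L2 (loop L) × L2 tail)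

/-- The delta condition at the vertex, for `v` in `H²`:
`v_c(L) = v_c(-L) = v_h(0) =: a` and `v_c'(-L) - v_c'(L) + v_h'(0) = γ a`. The second condition is
on the sum of the derivatives taken from the vertex into the edges. -/
def VertexCondition (L γ : ℝ) (v : L2Tadpole L) : Prop :=
  ∃ a p q r : ℂ,
    HasTrace (loop L) v.fst L a ∧ HasTrace (loop L) v.fst (-L) a ∧ HasTrace tail v.snd 0 a ∧
    HasTrace (loop L) (weakDeriv (loop L) v.fst) (-L) p ∧
    HasTrace (loop L) (weakDeriv (loop L) v.fst) L q ∧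
    HasTrace tail (weakDeriv tail v.snd) 0 r ∧
    p - q + r = γ * a

/-- The operator `H_γ v = (-v_c'', -v_h'')` in `L²`, with domain the functions `v` in `H²` which
satisfy the delta condition at the vertex. -/
def deltaLaplacian (L γ : ℝ) : L2Tadpole L →ₗ.[ℂ] L2Tadpole L where
  domain :=
    { carrier := {v | MemH2 (loop L) v.fst ∧ MemH2 tail v.snd ∧ VertexCondition L γ v}
      zero_mem' := by
        refine ⟨⟨0, 0, .zero, .zero⟩, ⟨0, 0, .zero, .zero⟩, 0, 0, 0, 0,
          .zero, .zero, .zero, ?_, ?_, ?_, by simp⟩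
        · rw [WithLp.zero_fst, weakDeriv_zero isOpen_Ioo]; exact .zero
        · rw [WithLp.zero_fst, weakDeriv_zero isOpen_Ioo]; exact .zero
        · rw [WithLp.zero_snd, weakDeriv_zero isOpen_Ioi]; exact .zero
      add_mem' := by
        rintro v w ⟨h1, h2, a, p, q, r, k1, k2, k3, k4, k5, k6, k7⟩
          ⟨h1', h2', a', p', q', r', k1', k2', k3', k4', k5', k6', k7'⟩
        refine ⟨h1.add h1', h2.add h2', a + a', p + p', q + q', r + r', k1.add k1', k2.add k2',
          k3.add k3', ?_, ?_, ?_, ?_⟩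
        · rw [WithLp.add_fst, h1.weakDeriv_add isOpen_Ioo h1']; exact k4.add k4'
        · rw [WithLp.add_fst, h1.weakDeriv_add isOpen_Ioo h1']; exact k5.add k5'
        · rw [WithLp.add_snd, h2.weakDeriv_add isOpen_Ioi h2']; exact k6.add k6'
        · linear_combination k7 + k7'
      smul_mem' := by
        rintro c v ⟨h1, h2, a, p, q, r, k1, k2, k3, k4, k5, k6, k7⟩
        refine ⟨h1.smul c, h2.smul c, c • a, c • p, c • q, c • r, k1.smul c, k2.smul c,
          k3.smul c, ?_, ?_, ?_, ?_⟩
        · rw [WithLp.smul_fst, h1.weakDeriv_smul isOpen_Ioo]; exact k4.smul c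
        · rw [WithLp.smul_fst, h1.weakDeriv_smul isOpen_Ioo]; exact k5.smul c
        · rw [WithLp.smul_snd, h2.weakDeriv_smul isOpen_Ioi]; exact k6.smul c
        · simp only [smul_eq_mul]; linear_combination c * k7 }
  toFun :=
    { toFun := fun v => WithLp.toLp 2
        (-weakDeriv (loop L) (weakDeriv (loop L) v.1.fst),
          -weakDeriv tail (weakDeriv tail v.1.snd))
      map_add' := by
        rintro ⟨v, h1, h2, -⟩ ⟨w, h1', h2', -⟩
        apply WithLp.ofLp_injective
        refine Prod.ext ?_ ?_
        · change -weakDeriv (loop L) (weakDeriv (loop L) (v.fst + w.fst)) = -_ + -_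
          rw [h1.weakDeriv2_add isOpen_Ioo h1', neg_add]
        · change -weakDeriv tail (weakDeriv tail (v.snd + w.snd)) = -_ + -_
          rw [h2.weakDeriv2_add isOpen_Ioi h2', neg_add]
      map_smul' := by
        rintro c ⟨v, h1, h2, -⟩
        apply WithLp.ofLp_injective
        refine Prod.ext ?_ ?_
        · change -weakDeriv (loop L) (weakDeriv (loop L) (c • v.fst)) = c • -_
          rw [h1.weakDeriv2_smul isOpen_Ioo, smul_neg]
        · change -weakDeriv tail (weakDeriv tail (c • v.snd)) = c • -_
          rw [h2.weakDeriv2_smul isOpen_Ioi, smul_neg] }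

end Tadpole

end

/-! Off `[0, ∞)` every spectral parameter is `-κ²` with `0 < re κ`, and the vertex turns the
spectral problem into one scalar equation. An `L²` solution of `v'' = κ² v` decays like `exp (-κ x)`
on the tail. On the loop, equality of the two end values removes the odd part, because `sinh (κ L) ≠
0`, so `v_c` is a multiple of `cosh (κ x)`. The delta condition then reads `charFn L γ κ = 0`
(`eigenfunction_form`).

If `charFn L γ κ ≠ 0`, the same algebra gives the resolvent: solve on each edge with the Green
function of the line (`exists_isPrim_green`), then add homogeneous solutions to restore the vertex
conditions (`exists_resolvent_solution`). If `charFn L γ κ = 0`, then `-κ²` is a simple eigenvalue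
(`eigenspace_neg_sq`).

Self-adjointness is not used: that the zeros are real is read off the characteristic function itself
(`im_eq_zero_of_charFn_eq_zero`). For real `κ = k > 0`, division by `cosh (k L)` gives `k (2 tanh (k
L) + 1) = -γ`. The left side increases strictly from `0` without bound, so there is one positive
solution when `γ < 0` and none when `γ ≥ 0`.

Each point of `[0, ∞)` lies in the spectrum by a Weyl sequence on the tail (`sq_mem_spectrum`), and
therefore none of them is isolated.

The domain is described by weak derivatives and traces. To work with it, weak solutions are shown to
be genuine exponentials (`exists_ae_eq_exp_add_exp`), and explicit functions are shown to lie in the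
domain (`exists_mem_domain`); the latter uses primitives of locally integrable functions, since the
Green solutions need not be `C²`. -/

noncomputable section

namespace Tadpole

/-! ### Primitives -/

section

/-- `F` is a primitive of the locally integrable function `g`. -/
structure IsPrim (F g : ℝ → ℂ) : Prop where
  locallyIntegrable : LocallyIntegrable g
  sub_eq : ∀ a b, F b - F a = ∫ x in a..b, g x

namespace IsPrim

variable {F F' g g' : ℝ → ℂ}

lemma intervalIntegrable (h : IsPrim F g) (a b : ℝ) : IntervalIntegrable g volume a b :=
  (h.locallyIntegrable.integrableOn_isCompact isCompact_uIcc).intervalIntegrable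

lemma continuous (h : IsPrim F g) : Continuous F := by
  have e : F = fun x => F 0 + ∫ t in (0 : ℝ)..x, g t := by
    funext x
    rw [← h.sub_eq]; ring
  rw [e]
  exact continuous_const.add
    (intervalIntegral.continuous_primitive (fun a b => h.intervalIntegrable a b) 0)

lemma add (h : IsPrim F g) (h' : IsPrim F' g') :
    IsPrim (fun x => F x + F' x) (fun x => g x + g' x) := by
  refine ⟨h.1.add h'.1, fun a b => ?_⟩
  rw [intervalIntegral.integral_add (h.intervalIntegrable a b) (h'.intervalIntegrable a b),
    ← h.sub_eq, ← h'.sub_eq]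
  ring

lemma const_mul (c : ℂ) (h : IsPrim F g) : IsPrim (fun x => c * F x) (fun x => c * g x) := by
  refine ⟨h.1.smul c, fun a b => ?_⟩
  rw [intervalIntegral.integral_const_mul, ← h.sub_eq]
  ring

lemma of_hasDerivAt (h : ∀ x, HasDerivAt F (g x) x) (hg : Continuous g) : IsPrim F g :=
  ⟨hg.locallyIntegrable, fun a b =>
    (intervalIntegral.integral_eq_sub_of_hasDerivAt (fun x _ => h x)
      (hg.intervalIntegrable a b)).symm⟩

lemma congr_right (h : IsPrim F g) (e : ∀ x, g x = g' x) : IsPrim F g' := by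
  rwa [← funext e]

/-- The product rule, with a continuously differentiable factor. -/
lemma mul {e e' : ℝ → ℂ} (he : ∀ x, HasDerivAt e (e' x) x) (he' : Continuous e')
    (h : IsPrim F g) : IsPrim (fun x => e x * F x) (fun x => e' x * F x + e x * g x) := by
  have hec : Continuous e := continuous_iff_continuousAt.2 fun x => (he x).continuousAt
  have hF := h.continuous
  have hi2 : LocallyIntegrable (fun x => e x * g x) := by
    have := h.locallyIntegrable.continuous_mul hec
    exact this
  have hi1 : LocallyIntegrable (fun x => e' x * F x) := (he'.mul hF).locallyIntegrable
  have hj1 : ∀ a b, IntervalIntegrable (fun x => e' x * F x) volume a b := fun a b =>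
    (hi1.integrableOn_isCompact isCompact_uIcc).intervalIntegrable
  have hj2 : ∀ a b, IntervalIntegrable (fun x => e x * g x) volume a b := fun a b =>
    (hi2.integrableOn_isCompact isCompact_uIcc).intervalIntegrable
  refine ⟨hi1.add hi2, ?_⟩
  suffices H : ∀ a b, a ≤ b → e b * F b - e a * F a =
      ∫ x in a..b, (e' x * F x + e x * g x) by
    intro a b
    rcases le_total a b with hab | hab
    · exact H a b hab
    · rw [intervalIntegral.integral_symm, ← H b a hab]; ring
  intro a b hab
  rw [intervalIntegral.integral_add (hj1 a b) (hj2 a b)]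
  -- `F` need not be differentiable. It is written as `F a` plus the integral of `g` from `a`, so
  -- that the product rule reduces to Fubini on the triangle `y ≤ x`.
  have e1 : ∫ x in a..b, e' x * F x =
      (∫ x in a..b, e' x * F a) + ∫ x in a..b, e' x * (∫ y in a..x, g y) := by
    rw [← intervalIntegral.integral_add]
    · refine intervalIntegral.integral_congr fun x _ => ?_
      rw [← h.sub_eq]; ring
    · exact (he'.mul continuous_const).intervalIntegrable _ _
    · refine (he'.mul ?_).intervalIntegrable _ _
      exact intervalIntegral.continuous_primitive (fun a b => h.intervalIntegrable a b) a
  have hE : ∀ a b, ∫ x in a..b, e' x = e b - e a := fun a b =>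
    intervalIntegral.integral_eq_sub_of_hasDerivAt (fun x _ => he x) (he'.intervalIntegrable a b)
  have e2 : ∫ x in a..b, e' x * (∫ y in a..x, g y) =
      ∫ y in a..b, (∫ x in y..b, e' x) * g y := by
    have hgi : IntegrableOn g (Ioc a b) :=
      (intervalIntegrable_iff_integrableOn_Ioc_of_le hab).1 (h.intervalIntegrable a b)
    have hei : IntegrableOn e' (Ioc a b) :=
      (intervalIntegrable_iff_integrableOn_Ioc_of_le hab).1 (he'.intervalIntegrable a b)
    rw [intervalIntegral.integral_of_le hab, intervalIntegral.integral_of_le hab]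
    have s1 : ∫ x in Ioc a b, e' x * (∫ y in a..x, g y) =
        ∫ x in Ioc a b, ∫ y in Ioc a b,
          {p : ℝ × ℝ | p.2 ≤ p.1}.indicator (fun p => e' p.1 * g p.2) (x, y) := by
      refine setIntegral_congr_fun measurableSet_Ioc fun x hx => ?_
      rw [intervalIntegral.integral_of_le hx.1.le, ← integral_const_mul,
        ← integral_indicator measurableSet_Ioc, ← integral_indicator measurableSet_Ioc]
      congr 1
      funext y
      simp only [indicator, mem_Ioc, mem_ofPred_eq]
      have := hx.2
      split_ifs <;> first | rfl | (exfalso; grind)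
    have s2 : ∫ y in Ioc a b, (∫ x in y..b, e' x) * g y =
        ∫ y in Ioc a b, ∫ x in Ioc a b,
          {p : ℝ × ℝ | p.2 ≤ p.1}.indicator (fun p => e' p.1 * g p.2) (x, y) := by
      refine setIntegral_congr_fun measurableSet_Ioc fun y hy => ?_
      rw [intervalIntegral.integral_of_le hy.2, ← integral_Icc_eq_integral_Ioc,
        ← integral_mul_const,
        ← integral_indicator measurableSet_Icc, ← integral_indicator measurableSet_Ioc]
      congr 1
      funext x
      simp only [indicator, mem_Ioc, mem_Icc, mem_ofPred_eq]
      have := hy.1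
      split_ifs <;> first | rfl | (exfalso; grind)
    rw [s1, s2]
    refine integral_integral_swap ?_
    have hm : MeasurableSet {p : ℝ × ℝ | p.2 ≤ p.1} :=
      measurableSet_le measurable_snd measurable_fst
    exact (hei.mul_prod hgi).indicator hm
  have e3 : ∫ y in a..b, (∫ x in y..b, e' x) * g y =
      (∫ y in a..b, e b * g y) - ∫ y in a..b, e y * g y := by
    rw [← intervalIntegral.integral_sub ((h.intervalIntegrable a b).const_mul _)
      (hj2 a b)]
    refine intervalIntegral.integral_congr fun y _ => ?_
    rw [hE]; ring
  rw [e1, e2, e3, intervalIntegral.integral_mul_const, hE, intervalIntegral.integral_const_mul,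
    ← h.sub_eq]
  ring

/-- Integration by parts against test functions. -/
lemma integral_deriv_smul (h : IsPrim F g) {φ : ℝ → ℝ} (h1 : ContDiff ℝ ∞ φ)
    (h2 : HasCompactSupport φ) : ∫ x, deriv φ x • F x = - ∫ x, φ x • g x := by
  have hd : Continuous (deriv φ) := h1.continuous_deriv (by simp)
  have hD : ∀ x, HasDerivAt (fun x => (φ x : ℂ)) ((deriv φ x : ℝ) : ℂ) x := fun x =>
    ((h1.differentiable (by simp)) x).hasDerivAt.ofReal_comp
  have hp := IsPrim.mul hD (by fun_prop) h
  obtain ⟨R, hR0, hR⟩ : ∃ R > 0, tsupport φ ⊆ Ioo (-R) R := by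
    obtain ⟨R, hR⟩ := h2.isCompact.isBounded.subset_ball 0
    refine ⟨max R 1, by positivity, hR.trans ?_⟩
    rw [Real.ball_eq_Ioo]
    refine Ioo_subset_Ioo ?_ ?_ <;> simp
  have i1 : Integrable (fun x => deriv φ x • F x) :=
    h.continuous.locallyIntegrable.integrable_smul_left_of_hasCompactSupport hd h2.deriv
  have i2 : Integrable (fun x => φ x • g x) :=
    h.locallyIntegrable.integrable_smul_left_of_hasCompactSupport h1.continuous h2
  rw [eq_neg_iff_add_eq_zero, ← integral_add i1 i2]
  have hz : ∀ x, x ∉ Ioo (-R) R → φ x = 0 ∧ deriv φ x = 0 := fun x hx =>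
    ⟨image_eq_zero_of_notMem_tsupport fun h => hx (hR h),
      image_eq_zero_of_notMem_tsupport fun h => hx (hR (tsupport_deriv_subset h))⟩
  -- The function `φ F` vanishes at `±R`, so the integral of its derivative over `(-R, R)` is zero.
  have key := hp.sub_eq (-R) R
  rw [(hz R (by simp)).1, (hz (-R) (by simp)).1, intervalIntegral.integral_of_le (by linarith),
    ← integral_indicator measurableSet_Ioc] at key
  simp only [Complex.ofReal_zero, zero_mul, sub_zero] at key
  rw [key]
  congr 1
  funext x
  by_cases hx : x ∈ Ioc (-R) R
  · simp [indicator_of_mem hx]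
  · rw [indicator_of_notMem hx]
    have := hz x fun h => hx ⟨h.1, h.2.le⟩
    simp [this.1, this.2]

lemma hasWeakDeriv (h : IsPrim F g) (U : Set ℝ)
    (hF : MemLp F 2 (volume.restrict U)) (hg : MemLp g 2 (volume.restrict U)) :
    HasWeakDeriv U (hF.toLp F) (hg.toLp g) := by
  intro φ h1 h2 h3
  have a1 : ∫ x in U, deriv φ x • (hF.toLp F) x = ∫ x, deriv φ x • F x := by
    have : ∫ x in U, deriv φ x • F x = ∫ x, deriv φ x • F x :=
      setIntegral_eq_integral_of_forall_compl_eq_zero fun x hx => by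
        rw [image_eq_zero_of_notMem_tsupport fun h => hx (h3 (tsupport_deriv_subset h)), zero_smul]
    rw [← this]
    refine integral_congr_ae ?_
    filter_upwards [hF.coeFn_toLp] with x hx
    rw [hx]
  have a2 : ∫ x in U, φ x • (hg.toLp g) x = ∫ x, φ x • g x := by
    have : ∫ x in U, φ x • g x = ∫ x, φ x • g x :=
      setIntegral_eq_integral_of_forall_compl_eq_zero fun x hx => by
        rw [image_eq_zero_of_notMem_tsupport fun h => hx (h3 h), zero_smul]
    rw [← this]
    refine integral_congr_ae ?_
    filter_upwards [hg.coeFn_toLp] with x hx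
    rw [hx]
  rw [a1, a2, h.integral_deriv_smul h1 h2]

end IsPrim

end

/-! ### Weak solutions -/

section

/-- A test function on an open interval with integral zero is the derivative of a test function. -/
lemma exists_deriv_eq_of_integral_eq_zero {U : Set ℝ} (hc : U.OrdConnected) {η : ℝ → ℝ}
    (h1 : ContDiff ℝ ∞ η) (h2 : HasCompactSupport η) (h3 : tsupport η ⊆ U)
    (h0 : ∫ x, η x = 0) :
    ∃ ψ : ℝ → ℝ, ContDiff ℝ ∞ ψ ∧ HasCompactSupport ψ ∧ tsupport ψ ⊆ U ∧ deriv ψ = η := by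
  rcases (tsupport η).eq_empty_or_nonempty with he | hne
  · refine ⟨0, contDiff_const, HasCompactSupport.zero, by simp, ?_⟩
    rw [tsupport_eq_empty_iff] at he
    rw [he]; funext x; simp
  have hη : Continuous η := h1.continuous
  have hi : Integrable η := hη.integrable_of_hasCompactSupport h2
  have ha := h2.isCompact.sInf_mem hne
  have hb := h2.isCompact.sSup_mem hne
  set a := sInf (tsupport η)
  set b := sSup (tsupport η)
  have hab : ∀ x, x ∉ Icc a b → η x = 0 := fun x hx => by
    refine image_eq_zero_of_notMem_tsupport fun h => hx ⟨?_, ?_⟩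
    · exact csInf_le h2.isCompact.bddBelow h
    · exact le_csSup h2.isCompact.bddAbove h
  -- This primitive vanishes to the left of the support of `η`, and to its right because the total
  -- integral is zero.
  let ψ : ℝ → ℝ := fun x => ∫ t in Iic x, η t
  have hψ : ∀ x, HasDerivAt ψ (η x) x := by
    intro x
    have e : ψ = fun x => (∫ t in Iic 0, η t) + ∫ t in (0 : ℝ)..x, η t := by
      funext x
      rw [← intervalIntegral.integral_Iic_sub_Iic hi.integrableOn hi.integrableOn]
      simp [ψ]
    rw [e]
    exact (intervalIntegral.integral_hasDerivAt_right (hη.intervalIntegrable _ _)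
      (hη.stronglyMeasurableAtFilter _ _) hη.continuousAt).const_add _
  have hder : deriv ψ = η := funext fun x => (hψ x).deriv
  have hsupp : tsupport ψ ⊆ Icc a b := by
    refine closure_minimal (fun x hx => ?_) isClosed_Icc
    by_contra hx'
    refine hx ?_
    rcases lt_or_ge x a with hxa | hxa
    · refine (setIntegral_congr_fun measurableSet_Iic fun t ht => ?_).trans (integral_zero _ _)
      exact hab t fun h => absurd (h.1.trans ht) (not_le.2 hxa)
    · have hxb : b < x := not_le.1 fun h => hx' ⟨hxa, h⟩
      refine Eq.trans (setIntegral_eq_integral_of_forall_compl_eq_zero fun t ht => ?_) h0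
      exact hab t fun h => ht (h.2.trans hxb.le)
  refine ⟨ψ, ?_, HasCompactSupport.of_support_subset_isCompact isCompact_Icc
    ((subset_tsupport ψ).trans hsupp), hsupp.trans (hc.out (h3 ha) (h3 hb)), hder⟩
  rw [contDiff_infty_iff_deriv]
  exact ⟨fun x => (hψ x).differentiableAt, by rwa [hder]⟩

/-- A locally integrable function on an open interval with vanishing weak derivative is constant. -/
lemma exists_ae_eq_const {U : Set ℝ} (hU : IsOpen U) (hc : U.OrdConnected) (hne : U.Nonempty)
    {f : ℝ → ℂ} (hf : LocallyIntegrable f (volume.restrict U))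
    (h : ∀ φ : ℝ → ℝ, ContDiff ℝ ∞ φ → HasCompactSupport φ → tsupport φ ⊆ U →
      ∫ x in U, deriv φ x • f x = 0) :
    ∃ c : ℂ, f =ᵐ[volume.restrict U] fun _ => c := by
  obtain ⟨x₀, hx₀⟩ := hne
  obtain ⟨r, hr, hrU⟩ := Metric.isOpen_iff.1 hU x₀ hx₀
  let B : ContDiffBump x₀ := ⟨r / 4, r / 2, by linarith, by linarith⟩
  let ρ : ℝ → ℝ := B.normed volume
  have ρ1 : ContDiff ℝ ∞ ρ := B.contDiff_normed
  have ρ2 : HasCompactSupport ρ := B.hasCompactSupport_normed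
  have ρ3 : tsupport ρ ⊆ U := by
    rw [show tsupport ρ = Metric.closedBall x₀ (r / 2) from B.tsupport_normed_eq]
    exact (Metric.closedBall_subset_ball (by linarith)).trans hrU
  have ρ0 : ∫ x, ρ x = 1 := B.integral_normed
  have hint : ∀ φ : ℝ → ℝ, Continuous φ → HasCompactSupport φ →
      Integrable (fun x => φ x • f x) (volume.restrict U) := fun φ k1 k2 =>
    hf.integrable_smul_left_of_hasCompactSupport k1 k2
  -- Du Bois-Reymond: `φ - (∫ φ) ρ` has integral zero, hence is the derivative of a test function
  -- and is annihilated by `f`. This identifies the constant as the mean of `f` against `ρ`.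
  refine ⟨∫ x in U, ρ x • f x, ?_⟩
  set c := ∫ x in U, ρ x • f x
  have hcl : LocallyIntegrable (fun x => f x - c) (volume.restrict U) :=
    hf.sub (locallyIntegrable_const c)
  have key := hU.ae_eq_zero_of_integral_contDiff_smul_eq_zero (hcl.locallyIntegrableOn U)
    (fun φ k1 k2 k3 => by
      set m := ∫ x, φ x
      have hφi : Integrable φ := k1.continuous.integrable_of_hasCompactSupport k2
      have hρi : Integrable ρ := ρ1.continuous.integrable_of_hasCompactSupport ρ2
      have q2 : HasCompactSupport fun x => m * ρ x := ρ2.mul_left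
      have q3 : tsupport (fun x => m * ρ x) ⊆ U :=
        (closure_mono (Function.support_mul_subset_right _ _)).trans ρ3
      obtain ⟨ψ, p1, p2, p3, p4⟩ := exists_deriv_eq_of_integral_eq_zero hc
        (η := φ - fun x => m * ρ x) (k1.sub (contDiff_const.mul ρ1)) (k2.sub q2)
        ((tsupport_sub _ _).trans (union_subset k3 q3))
        (by
          simp only [Pi.sub_apply]
          rw [integral_sub hφi (hρi.const_mul m), integral_const_mul, ρ0]
          simp [m])
      have hz := h ψ p1 p2 p3
      rw [p4] at hz
      have e1 : ∫ x in U, (φ - fun x => m * ρ x) x • f x =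
          (∫ x in U, φ x • f x) - m • c := by
        rw [← integral_smul, ← integral_sub (hint φ k1.continuous k2)
          ((hint ρ ρ1.continuous ρ2).fun_smul m)]
        refine integral_congr_ae (Filter.Eventually.of_forall fun x => ?_)
        simp only [Pi.sub_apply, sub_smul, mul_smul]
      have e2 : ∫ x in U, φ x • (f x - c) = (∫ x in U, φ x • f x) - m • c := by
        have hm : ∫ x in U, φ x = m :=
          setIntegral_eq_integral_of_forall_compl_eq_zero fun x hx =>
            image_eq_zero_of_notMem_tsupport fun h => hx (k3 h)
        rw [← hm, ← integral_smul_const, ← integral_sub (hint φ k1.continuous k2)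
          (hφi.integrableOn.smul_const c)]
        simp only [smul_sub]
      rw [e2, ← e1, hz])
  filter_upwards [key, ae_restrict_mem hU.measurableSet] with x hx hxU
  exact sub_eq_zero.1 (hx hxU)

/-- Testing a weak derivative with complex valued functions. -/
lemma HasWeakDeriv.integral_mul {U : Set ℝ} {f g : L2 U} (h : HasWeakDeriv U f g) {φ : ℝ → ℂ}
    (h1 : ContDiff ℝ ∞ φ) (h2 : HasCompactSupport φ) (h3 : tsupport φ ⊆ U) :
    ∫ x in U, deriv φ x * f x = - ∫ x in U, φ x * g x := by
  have hdiff : Differentiable ℝ φ := h1.differentiable (by simp)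
  have main : ∀ (A : ℂ →L[ℝ] ℝ),
      ∫ x in U, A (deriv φ x) • f x = - ∫ x in U, A (φ x) • g x := by
    intro A
    have hd : deriv (fun x => A (φ x)) = fun x => A (deriv φ x) := by
      funext x
      exact (A.hasFDerivAt.comp_hasDerivAt x (hdiff x).hasDerivAt).deriv
    have := h (fun x => A (φ x)) (A.contDiff.comp h1) (h2.comp_left (map_zero A))
      ((closure_mono (Function.support_comp_subset (map_zero A) φ)).trans h3)
    rwa [hd] at this
  have hint : ∀ (F : L2 U) (θ : ℝ → ℂ), Continuous θ → HasCompactSupport θ → ∀ A : ℂ →L[ℝ] ℝ,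
      Integrable (fun x => A (θ x) • F x) (volume.restrict U) := fun F θ k1 k2 A =>
    F.integrable_smul (A.continuous.comp k1) (k2.comp_left (map_zero A))
  have split : ∀ (F : L2 U) (θ : ℝ → ℂ), Continuous θ → HasCompactSupport θ →
      ∫ x in U, θ x * F x = (∫ x in U, Complex.reCLM (θ x) • F x) +
        Complex.I * ∫ x in U, Complex.imCLM (θ x) • F x := by
    intro F θ k1 k2
    rw [← integral_const_mul, ← integral_add (hint F θ k1 k2 _) ((hint F θ k1 k2 _).const_mul _)]
    refine integral_congr_ae (Filter.Eventually.of_forall fun x => ?_)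
    simp only [Complex.reCLM_apply, Complex.imCLM_apply, Complex.real_smul]
    conv_lhs => rw [← Complex.re_add_im (θ x)]
    ring
  rw [split f _ (h1.continuous_deriv (by simp)) h2.deriv, split g _ h1.continuous h2,
    main, main]
  ring

lemma hasDerivAt_cexp_mul (κ : ℂ) (x : ℝ) :
    HasDerivAt (fun x : ℝ => Complex.exp (κ * x)) (κ * Complex.exp (κ * x)) x := by
  have h : HasDerivAt (fun x : ℝ => κ * (x : ℂ)) (κ * 1) x :=
    (Complex.ofRealCLM.hasDerivAt (x := x)).const_mul κ
  convert h.cexp using 1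
  ring

lemma contDiff_cexp_mul (κ : ℂ) : ContDiff ℝ ∞ (fun x : ℝ => Complex.exp (κ * x)) :=
  (contDiff_const.mul Complex.ofRealCLM.contDiff).cexp

/-- Weak solutions of `w' = κ w` are multiples of `exp (κ x)`. -/
lemma HasWeakDeriv.exists_ae_eq_exp {U : Set ℝ} (hU : IsOpen U) (hc : U.OrdConnected)
    (hne : U.Nonempty) {w : L2 U} {κ : ℂ} (h : HasWeakDeriv U w (κ • w)) :
    ∃ c : ℂ, w =ᵐ[volume.restrict U] fun x => c * Complex.exp (κ * x) := by
  have hli : LocallyIntegrable w (volume.restrict U) := (Lp.memLp w).locallyIntegrable (by norm_num)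
  have hl : LocallyIntegrable (fun x : ℝ => Complex.exp (-κ * x) * w x) (volume.restrict U) :=
    hli.continuous_mul (contDiff_cexp_mul (-κ)).continuous
  obtain ⟨c, hc⟩ := exists_ae_eq_const hU hc hne hl fun φ h1 h2 h3 => by
    have hφ : Differentiable ℝ φ := h1.differentiable (by simp)
    have hφC : ContDiff ℝ ∞ (fun x => (φ x : ℂ)) := Complex.ofRealCLM.contDiff.comp h1
    have hcs : HasCompactSupport (fun x => (φ x : ℂ)) :=
      h2.comp_left (g := Complex.ofReal) Complex.ofReal_zero
    have hts : tsupport (fun x => (φ x : ℂ)) ⊆ U :=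
      (closure_mono (Function.support_comp_subset (g := Complex.ofReal)
        Complex.ofReal_zero φ)).trans h3
    -- Integrating factor: testing `w' = κ w` with `θ`, the term from differentiating the
    -- exponential cancels the right-hand side, and `exp (-κ x) w` has weak derivative zero.
    set θ : ℝ → ℂ := fun x => φ x * Complex.exp (-κ * x)
    have θ1 : ContDiff ℝ ∞ θ := hφC.mul (contDiff_cexp_mul (-κ))
    have θ2 : HasCompactSupport θ := hcs.mul_right
    have θ3 : tsupport θ ⊆ U :=
      (closure_mono (Function.support_mul_subset_left _ _)).trans hts
    have hd : ∀ x, deriv θ x = deriv φ x * Complex.exp (-κ * x) - κ * θ x := by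
      intro x
      have := ((hφ x).hasDerivAt.ofReal_comp.mul (hasDerivAt_cexp_mul (-κ) x)).deriv
      refine this.trans ?_
      simp only [θ]; ring
    have k := h.integral_mul θ1 θ2 θ3
    have hI : Integrable (fun x => θ x * (κ • w : L2 U) x) (volume.restrict U) :=
      ((Lp.memLp (κ • w)).locallyIntegrable (by norm_num)).integrable_smul_left_of_hasCompactSupport
        θ1.continuous θ2
    have hJ : Integrable (fun x => deriv θ x * w x) (volume.restrict U) :=
      hli.integrable_smul_left_of_hasCompactSupport (θ1.continuous_deriv (by simp)) θ2.deriv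
    rw [eq_neg_iff_add_eq_zero, ← integral_add hJ hI] at k
    rw [← k]
    refine integral_congr_ae ?_
    filter_upwards [Lp.coeFn_smul κ w] with x hx
    rw [hx, hd, Pi.smul_apply, smul_eq_mul, Complex.real_smul]
    simp only [θ]
    ring
  refine ⟨c, ?_⟩
  filter_upwards [hc] with x hx
  rw [← hx, mul_right_comm, ← Complex.exp_add]
  simp

end

/-! ### The Green function of the line -/

section

open scoped ENNReal NNReal

/-- The convolution of the exponential kernel `exp (-a |x|)` with `‖f‖`. -/
def expConv (a : ℝ) (f : ℝ → ℂ) (x : ℝ) : ℝ≥0∞ :=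
  ∫⁻ y, ENNReal.ofReal (Real.exp (-a * |x - y|)) * ‖f y‖ₑ

lemma integrable_exp_neg_mul_abs {a : ℝ} (ha : 0 < a) :
    Integrable (fun x : ℝ => Real.exp (-a * |x|)) := by
  rw [← integrableOn_univ, ← Iic_union_Ioi (a := (0 : ℝ)), integrableOn_union]
  constructor
  · refine (integrableOn_exp_mul_Iic ha 0).congr_fun (fun x hx => ?_) measurableSet_Iic
    simp only [abs_of_nonpos (mem_Iic.1 hx)]
    congr 1; ring
  · refine (integrableOn_exp_mul_Ioi (neg_lt_zero.2 ha) 0).congr_fun (fun x hx => ?_)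
      measurableSet_Ioi
    simp only [abs_of_pos (mem_Ioi.1 hx)]

lemma lintegral_exp_neg_mul_abs_lt_top {a : ℝ} (ha : 0 < a) :
    ∫⁻ x : ℝ, ENNReal.ofReal (Real.exp (-a * |x|)) < ⊤ :=
  (integrable_exp_neg_mul_abs ha).lintegral_lt_top

lemma measurable_expKernel (a : ℝ) :
    Measurable fun x : ℝ => ENNReal.ofReal (Real.exp (-a * |x|)) := by
  have : Continuous fun x : ℝ => Real.exp (-a * |x|) := by fun_prop
  exact this.measurable.ennreal_ofReal

/-- Cauchy–Schwarz: squaring the kernel doubles its rate, and translation invariance makes the bound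
independent of `x`. This is what controls the values at the vertex. -/
lemma expConv_le (a : ℝ) {f : ℝ → ℂ} (hf : Measurable f) (x : ℝ) :
    expConv a f x ≤ (∫⁻ y, ENNReal.ofReal (Real.exp (-(2 * a) * |y|))) ^ (1 / 2 : ℝ) *
      eLpNorm f 2 volume := by
  have hk : Measurable fun y : ℝ => ENNReal.ofReal (Real.exp (-a * |x - y|)) :=
    (measurable_expKernel a).comp (measurable_const.sub measurable_id)
  refine (ENNReal.lintegral_mul_le_Lp_mul_Lq volume Real.HolderConjugate.two_two hk.aemeasurable
    hf.enorm.aemeasurable).trans (le_of_eq ?_)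
  rw [eLpNorm_eq_lintegral_rpow_enorm_toReal (by norm_num) (by norm_num)]
  congr 2
  rw [← lintegral_sub_left_eq_self (fun y => ENNReal.ofReal (Real.exp (-(2 * a) * |y|))) x]
  refine lintegral_congr fun y => ?_
  rw [ENNReal.ofReal_rpow_of_pos (Real.exp_pos _), ← Real.exp_mul]
  congr 2; ring

/-- Young's inequality for the exponential kernel. -/
lemma lintegral_expConv_sq_le (a : ℝ) {f : ℝ → ℂ} (hf : Measurable f) :
    ∫⁻ x, expConv a f x ^ (2 : ℝ) ≤
      (∫⁻ y, ENNReal.ofReal (Real.exp (-a * |y|))) ^ (2 : ℝ) * ∫⁻ x, ‖f x‖ₑ ^ (2 : ℝ) := by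
  set k : ℝ → ℝ≥0∞ := fun x => ENNReal.ofReal (Real.exp (-a * |x|)) with hkdef
  have hk : Measurable k := measurable_expKernel a
  set A := ∫⁻ y, k y with hA
  have hk' : ∀ x, Measurable fun y => k (x - y) := fun x =>
    hk.comp (measurable_const.sub measurable_id)
  have hAl : ∀ x, ∫⁻ y, k (x - y) = A := fun x => lintegral_sub_left_eq_self k x
  have hAr : ∀ y, ∫⁻ x, k (x - y) = A := fun y => lintegral_sub_right_eq_self k y
  -- The kernel is split as `k^(1/2) * k^(1/2)` before Cauchy–Schwarz, so that one factor integrates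
  -- to `A` and the other stays with `f`.
  have hpt : ∀ x, expConv a f x ^ (2 : ℝ) ≤ A * ∫⁻ y, k (x - y) * ‖f y‖ₑ ^ (2 : ℝ) := by
    intro x
    have h1 := ENNReal.lintegral_mul_le_Lp_mul_Lq volume Real.HolderConjugate.two_two
      ((hk' x).pow_const (1 / 2 : ℝ)).aemeasurable
      (((hk' x).pow_const (1 / 2 : ℝ)).mul hf.enorm).aemeasurable
    have e0 : expConv a f x = ∫⁻ y, ((fun y => k (x - y) ^ (1 / 2 : ℝ)) *
        ((fun y => k (x - y) ^ (1 / 2 : ℝ)) * fun y => ‖f y‖ₑ)) y := by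
      refine lintegral_congr fun y => ?_
      simp only [Pi.mul_apply]
      rw [← mul_assoc, ← ENNReal.rpow_add_of_nonneg _ _ (by norm_num) (by norm_num)]
      norm_num [hkdef]
    have e1 : ∀ y, (k (x - y) ^ (1 / 2 : ℝ)) ^ (2 : ℝ) = k (x - y) := fun y => by
      rw [← ENNReal.rpow_mul]; norm_num
    rw [e0]
    refine (ENNReal.rpow_le_rpow h1 (by norm_num)).trans (le_of_eq ?_)
    rw [ENNReal.mul_rpow_of_nonneg _ _ (by norm_num), ← ENNReal.rpow_mul, ← ENNReal.rpow_mul]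
    simp only [Pi.mul_apply, ENNReal.mul_rpow_of_nonneg _ _ (show (0 : ℝ) ≤ 2 by norm_num), e1]
    norm_num [hAl]
  have hm : AEMeasurable (Function.uncurry fun x y => k (x - y) * ‖f y‖ₑ ^ (2 : ℝ))
      (volume.prod volume) := by
    refine Measurable.aemeasurable ?_
    exact (hk.comp (measurable_fst.sub measurable_snd)).mul
      ((hf.enorm.comp measurable_snd).pow_const _)
  have hm2 : Measurable fun x => ‖f x‖ₑ ^ (2 : ℝ) := hf.enorm.pow_const _
  have hAtop : ∀ g : ℝ → ℝ≥0∞, Measurable g → ∫⁻ x, A * g x = A * ∫⁻ x, g x := fun g hg =>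
    lintegral_const_mul _ hg
  calc ∫⁻ x, expConv a f x ^ (2 : ℝ)
      ≤ ∫⁻ x, A * ∫⁻ y, k (x - y) * ‖f y‖ₑ ^ (2 : ℝ) := lintegral_mono hpt
    _ = A * ∫⁻ x, ∫⁻ y, k (x - y) * ‖f y‖ₑ ^ (2 : ℝ) := by
        refine hAtop _ (Measurable.lintegral_prod_right'
          (f := fun p : ℝ × ℝ => k (p.1 - p.2) * ‖f p.2‖ₑ ^ (2 : ℝ)) ?_)
        exact (hk.comp (measurable_fst.sub measurable_snd)).mul
          ((hf.enorm.comp measurable_snd).pow_const _)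
    _ = A * ∫⁻ y, ∫⁻ x, k (x - y) * ‖f y‖ₑ ^ (2 : ℝ) := by
        rw [lintegral_lintegral_swap hm]
    _ = A * ∫⁻ y, A * ‖f y‖ₑ ^ (2 : ℝ) := by
        congr 1
        refine lintegral_congr fun y => ?_
        have hky : Measurable fun x => k (x - y) := hk.comp (measurable_id.sub measurable_const)
        rw [lintegral_mul_const _ hky, hAr]
    _ = A ^ (2 : ℝ) * ∫⁻ x, ‖f x‖ₑ ^ (2 : ℝ) := by
        rw [hAtop _ hm2, ← mul_assoc]
        norm_num [sq]

lemma expConv_comp_neg (a : ℝ) (f : ℝ → ℂ) (x : ℝ) :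
    expConv a (fun y => f (-y)) (-x) = expConv a f x := by
  unfold expConv
  rw [← lintegral_neg_eq_self]
  refine lintegral_congr fun y => ?_
  simp only [neg_neg, show -x - -y = -(x - y) by ring, abs_neg]

lemma eLpNorm_le_of_enorm_le_expConv {a : ℝ} (f u : ℝ → ℂ) (hf : Measurable f)
    {C : ℝ≥0∞} (h : ∀ x, ‖u x‖ₑ ≤ C * expConv a f x) (hC : C ≠ ⊤) :
    eLpNorm u 2 volume ≤
      C * (∫⁻ y, ENNReal.ofReal (Real.exp (-a * |y|))) * eLpNorm f 2 volume := by
  rw [eLpNorm_eq_lintegral_rpow_enorm_toReal (by norm_num) (by norm_num),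
    eLpNorm_eq_lintegral_rpow_enorm_toReal (by norm_num) (by norm_num)]
  simp only [ENNReal.toReal_ofNat]
  have h2 : ∫⁻ x, ‖u x‖ₑ ^ (2 : ℝ) ≤ (C * ∫⁻ y, ENNReal.ofReal (Real.exp (-a * |y|))) ^ (2 : ℝ) *
      ∫⁻ x, ‖f x‖ₑ ^ (2 : ℝ) := by
    calc ∫⁻ x, ‖u x‖ₑ ^ (2 : ℝ) ≤ ∫⁻ x, C ^ (2 : ℝ) * expConv a f x ^ (2 : ℝ) := by
          refine lintegral_mono fun x => ?_
          rw [← ENNReal.mul_rpow_of_nonneg _ _ (by norm_num)]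
          exact ENNReal.rpow_le_rpow (h x) (by norm_num)
      _ = C ^ (2 : ℝ) * ∫⁻ x, expConv a f x ^ (2 : ℝ) :=
          lintegral_const_mul' _ _ (ENNReal.rpow_ne_top_of_nonneg (by norm_num) hC)
      _ ≤ _ := by
          rw [ENNReal.mul_rpow_of_nonneg _ _ (by norm_num), mul_assoc]
          gcongr
          exact lintegral_expConv_sq_le a hf
  refine (ENNReal.rpow_le_rpow h2 (by norm_num : (0 : ℝ) ≤ 1 / 2)).trans (le_of_eq ?_)
  rw [ENNReal.mul_rpow_of_nonneg _ _ (by norm_num), ← ENNReal.rpow_mul]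
  norm_num

lemma IsPrim.comp_neg {F g : ℝ → ℂ} (h : IsPrim F g)
    (hg : LocallyIntegrable fun x => -g (-x)) : IsPrim (fun x => F (-x)) fun x => -g (-x) := by
  refine ⟨hg, fun a b => ?_⟩
  rw [intervalIntegral.integral_neg, intervalIntegral.integral_comp_neg, ← h.sub_eq]
  ring

/-- The causal solution of `P' = f - κ P`. -/
lemma exists_isPrim_sub_mul {κ : ℂ} (hκ : 0 < κ.re) {f : ℝ → ℂ} (hf : Measurable f)
    (hf2 : MemLp f 2) :
    ∃ P, IsPrim P (fun x => f x - κ * P x) ∧ ∀ x, ‖P x‖ₑ ≤ expConv κ.re f x := by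
  -- Variation of constants: `P x = exp (-κ x) ∫_{-∞}^x exp (κ y) f y dy`.
  set h : ℝ → ℂ := fun y => Complex.exp (κ * y) * f y
  have hnorm : ∀ x y : ℝ, y ≤ x → ‖Complex.exp (-κ * x) * h y‖ₑ =
      ENNReal.ofReal (Real.exp (-κ.re * |x - y|)) * ‖f y‖ₑ := by
    intro x y hxy
    simp only [h]
    rw [← mul_assoc, ← Complex.exp_add, enorm_mul, ← ofReal_norm (Complex.exp _),
      Complex.norm_exp, abs_of_nonneg (sub_nonneg.2 hxy)]
    congr 3
    simp [Complex.add_re, Complex.mul_re]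
    ring
  have hfin : ∀ x, expConv κ.re f x < ⊤ := fun x =>
    (expConv_le κ.re hf x).trans_lt (ENNReal.mul_lt_top (ENNReal.rpow_lt_top_of_nonneg
      (by norm_num) (lintegral_exp_neg_mul_abs_lt_top (by positivity)).ne) hf2.eLpNorm_lt_top)
  have hle : ∀ x : ℝ, ∫⁻ y in Iic x, ‖Complex.exp (-κ * x) * h y‖ₑ ≤ expConv κ.re f x := by
    intro x
    rw [setLIntegral_congr_fun measurableSet_Iic fun y hy => hnorm x y hy]
    exact setLIntegral_le_lintegral _ _
  have hmeas : Measurable h :=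
    (contDiff_cexp_mul κ).continuous.measurable.mul hf
  have hint : ∀ x : ℝ, IntegrableOn h (Iic x) := by
    intro x
    have : IntegrableOn (fun y : ℝ => Complex.exp (-κ * x) * h y) (Iic x) :=
      ⟨(measurable_const.mul hmeas).aestronglyMeasurable, (hle x).trans_lt (hfin x)⟩
    refine (this.const_mul (Complex.exp (κ * x))).congr (Filter.Eventually.of_forall fun y => ?_)
    simp only
    rw [← mul_assoc, ← Complex.exp_add]
    simp
  have hp : IsPrim (fun x => ∫ y in Iic x, h y) h := by
    refine ⟨(hf2.locallyIntegrable (by norm_num)).continuous_mul (contDiff_cexp_mul κ).continuous,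
      fun a b => ?_⟩
    exact intervalIntegral.integral_Iic_sub_Iic (hint a) (hint b)
  have hP := IsPrim.mul (hasDerivAt_cexp_mul (-κ))
    (continuous_const.mul (contDiff_cexp_mul (-κ)).continuous) hp
  refine ⟨_, hP.congr_right fun x => ?_, fun x => ?_⟩
  · have : Complex.exp (-κ * x) * h x = f x := by
      simp only [h]
      rw [← mul_assoc, ← Complex.exp_add]; simp
    rw [this]; ring
  · rw [← integral_const_mul]
    exact (enorm_integral_le_lintegral_enorm _).trans (hle x)

/-- Solutions of `u'' = κ² u - f` on the line, with `L²` and uniform bounds. -/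
lemma exists_isPrim_green {κ : ℂ} (hκ : 0 < κ.re) : ∃ C : ℝ≥0, ∀ f : ℝ → ℂ, Measurable f →
    MemLp f 2 → ∃ u g : ℝ → ℂ, IsPrim u g ∧ IsPrim g (fun x => κ ^ 2 * u x - f x) ∧
      (∀ x, ‖u x‖ₑ ≤ C * eLpNorm f 2 volume) ∧ (∀ x, ‖g x‖ₑ ≤ C * eLpNorm f 2 volume) ∧
      eLpNorm u 2 volume ≤ C * eLpNorm f 2 volume ∧
      eLpNorm g 2 volume ≤ C * eLpNorm f 2 volume := by
  have hκ0 : κ ≠ 0 := fun h => by simp [h] at hκ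
  set A := (∫⁻ y, ENNReal.ofReal (Real.exp (-(2 * κ.re) * |y|))) ^ (1 / 2 : ℝ) with hA
  set B := ∫⁻ y, ENNReal.ofReal (Real.exp (-κ.re * |y|)) with hB
  have hAt : A ≠ ⊤ := ENNReal.rpow_ne_top_of_nonneg (by norm_num)
    (lintegral_exp_neg_mul_abs_lt_top (by positivity)).ne
  have hBt : B ≠ ⊤ := (lintegral_exp_neg_mul_abs_lt_top hκ).ne
  -- The first summand serves `u`, the second `g`. Likewise in `A + B`, `A` gives the uniform bounds
  -- and `B` the `L²` bounds.
  set D : ℝ≥0∞ := 2 * ‖1 / (2 * κ)‖ₑ + 1 with hD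
  have hDt : D ≠ ⊤ := by finiteness
  have hCt : D * (A + B) ≠ ⊤ := by finiteness
  refine ⟨(D * (A + B)).toNNReal, fun f hf hf2 => ?_⟩
  rw [ENNReal.coe_toNNReal hCt]
  have hfl : LocallyIntegrable f := hf2.locallyIntegrable (by norm_num)
  obtain ⟨P, hP, hPb⟩ := exists_isPrim_sub_mul hκ hf hf2
  have hfn : MemLp (fun x => f (-x)) 2 :=
    hf2.comp_measurePreserving (Measure.measurePreserving_neg volume)
  obtain ⟨Q', hQ', hQb'⟩ := exists_isPrim_sub_mul hκ (hf.comp measurable_neg) hfn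
  have hQc : Continuous fun x => Q' (-x) := hQ'.continuous.comp continuous_neg
  have hQ := hQ'.comp_neg (by
    have : LocallyIntegrable fun x => κ * Q' (-x) - f x :=
      (continuous_const.mul hQc).locallyIntegrable.sub hfl
    convert this using 2 with x
    simp)
  have hQb : ∀ x, ‖Q' (-x)‖ₑ ≤ expConv κ.re f x := fun x =>
    (hQb' (-x)).trans (expConv_comp_neg κ.re f x).le
  -- With `Q x = Q' (-x)`, the anticausal counterpart of `P`, one has `P' = f - κ P` and `Q' = κ Q -
  -- f` as differential equations. So `u = (P + Q) / (2 κ)` is convolution of `f` with `exp (-κ |x|)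
  -- / (2 κ)`, and its derivative is `g = (Q - P) / 2`.
  have hu := (hP.add hQ).const_mul (1 / (2 * κ))
  have hg := (hP.const_mul (-1 / 2)).add (hQ.const_mul (1 / 2))
  have hub : ∀ x, ‖1 / (2 * κ) * (P x + Q' (-x))‖ₑ ≤ D * expConv κ.re f x := by
    intro x
    rw [enorm_mul]
    calc _ ≤ ‖1 / (2 * κ)‖ₑ * (expConv κ.re f x + expConv κ.re f x) := by
          gcongr
          exact (enorm_add_le _ _).trans (add_le_add (hPb x) (hQb x))
      _ = (2 * ‖1 / (2 * κ)‖ₑ) * expConv κ.re f x := by ring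
      _ ≤ _ := by
          gcongr
          exact le_self_add
  have hgb : ∀ x, ‖-1 / 2 * P x + 1 / 2 * Q' (-x)‖ₑ ≤ D * expConv κ.re f x := by
    intro x
    calc _ ≤ ‖(-1 / 2 : ℂ)‖ₑ * expConv κ.re f x + ‖(1 / 2 : ℂ)‖ₑ * expConv κ.re f x := by
          refine (enorm_add_le _ _).trans ?_
          rw [enorm_mul, enorm_mul]
          gcongr
          · exact hPb x
          · exact hQb x
      _ = 1 * expConv κ.re f x := by
          rw [← add_mul]
          congr 1
          rw [← ofReal_norm, ← ofReal_norm,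
            ← ENNReal.ofReal_add (norm_nonneg _) (norm_nonneg _)]
          norm_num
      _ ≤ _ := by
          gcongr
          exact le_add_self
  have sup : ∀ v : ℝ → ℂ, (∀ x, ‖v x‖ₑ ≤ D * expConv κ.re f x) → ∀ x,
      ‖v x‖ₑ ≤ D * (A + B) * eLpNorm f 2 volume := fun v hv x => by
    refine (hv x).trans ?_
    rw [mul_assoc]
    gcongr
    refine (expConv_le κ.re hf x).trans ?_
    gcongr
    exact le_self_add
  have l2 : ∀ v : ℝ → ℂ, (∀ x, ‖v x‖ₑ ≤ D * expConv κ.re f x) →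
      eLpNorm v 2 volume ≤ D * (A + B) * eLpNorm f 2 volume := fun v hv => by
    refine (eLpNorm_le_of_enorm_le_expConv f v hf hv hDt).trans ?_
    gcongr
    exact le_add_self
  refine ⟨_, _, hu.congr_right fun x => ?_, hg.congr_right fun x => ?_, sup _ hub, sup _ hgb,
    l2 _ hub, l2 _ hgb⟩
  · simp only [Function.comp_apply, neg_neg]
    field_simp
    ring
  · simp only [Function.comp_apply, neg_neg]
    field_simp
    ring

end

/-! ### The operator and its domain -/

section

/-! ### Abstract criteria for resolvent points -/

section Resolvent
variable {E : Type*} [NormedAddCommGroup E] [InnerProductSpace ℂ E]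

/-- Uniqueness makes the chosen solution depend linearly on `f`, so no linearity has to be built
into the construction of solutions. -/
lemma mem_resolventSet_of_bound {T : E →ₗ.[ℂ] E} {z : ℂ} (K : ℝ)
    (hex : ∀ f : E, ∃ v : T.domain, T v - z • (v : E) = f ∧ ‖(v : E)‖ ≤ K * ‖f‖)
    (huniq : ∀ v : T.domain, T v = z • (v : E) → v = 0) : z ∈ resolventSet T := by
  choose S hS hSb using hex
  have hinj : ∀ v w : T.domain, T v - z • (v : E) = T w - z • (w : E) → v = w := by
    intro v w h
    refine sub_eq_zero.1 (huniq (v - w) ?_)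
    rw [T.map_sub, Submodule.coe_sub, smul_sub]
    rw [sub_eq_sub_iff_add_eq_add] at h
    rw [sub_eq_sub_iff_add_eq_add, h]
    abel
  let R₀ : E →ₗ[ℂ] E :=
    { toFun := fun f => S f
      map_add' := fun f g => by
        rw [← Submodule.coe_add]
        refine congrArg _ (hinj _ _ ?_)
        rw [hS, T.map_add, Submodule.coe_add, smul_add, add_sub_add_comm, hS, hS]
      map_smul' := fun c f => by
        rw [RingHom.id_apply, ← Submodule.coe_smul]
        refine congrArg _ (hinj _ _ ?_)
        rw [hS, T.map_smul, Submodule.coe_smul, smul_comm z, ← smul_sub, hS] }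
  refine ⟨R₀.mkContinuous K hSb, fun f => ⟨(S f).2, hS f⟩, fun v => ?_⟩
  exact congrArg Subtype.val (hinj _ v (hS _))

/-- The estimate that an eigenvector or a Weyl sequence violates. -/
lemma resolventSet_bound {T : E →ₗ.[ℂ] E} {z : ℂ} (h : z ∈ resolventSet T) :
    ∃ K : ℝ, ∀ v : T.domain, ‖(v : E)‖ ≤ K * ‖T v - z • (v : E)‖ := by
  obtain ⟨R, -, hR⟩ := h
  refine ⟨‖R‖, fun v => ?_⟩
  conv_lhs => rw [← hR v]
  exact R.le_opNorm _

end Resolvent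

/-- Continuous functions that agree almost everywhere on an open set agree on it, and then on its
closure. Traces thus become point values of explicit representatives. -/
lemma HasTrace.eq_of_ae_eq {U : Set ℝ} (hU : IsOpen U) {f : L2 U} {x : ℝ} {y : ℂ}
    (h : HasTrace U f x y) (hx : x ∈ closure U) {w : ℝ → ℂ} (hw : Continuous w)
    (hfw : f =ᵐ[volume.restrict U] w) : y = w x := by
  obtain ⟨u, hu, hfu, rfl⟩ := h
  have h1 : EqOn u w U := Measure.eqOn_open_of_ae_eq (hfu.symm.trans hfw) hU
    (hu.mono subset_closure) hw.continuousOn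
  exact h1.of_subset_closure hu hw.continuousOn subset_closure subset_rfl hx

/-- `u` is in `H²(U)` with derivatives `g` and `k`, and `u`, `g` are primitives on the line. -/
structure IsH2 (U : Set ℝ) (u g k : ℝ → ℂ) : Prop where
  prim : IsPrim u g
  prim' : IsPrim g k
  memLp : MemLp u 2 (volume.restrict U)
  memLp' : MemLp g 2 (volume.restrict U)
  memLp'' : MemLp k 2 (volume.restrict U)

namespace IsH2
variable {U : Set ℝ} {u g k u' g' k' : ℝ → ℂ}

lemma add (h : IsH2 U u g k) (h' : IsH2 U u' g' k') :
    IsH2 U (fun x => u x + u' x) (fun x => g x + g' x) (fun x => k x + k' x) :=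
  ⟨h.1.add h'.1, h.2.add h'.2, h.3.add h'.3, h.4.add h'.4, h.5.add h'.5⟩

lemma const_mul (c : ℂ) (h : IsH2 U u g k) :
    IsH2 U (fun x => c * u x) (fun x => c * g x) (fun x => c * k x) :=
  ⟨h.1.const_mul c, h.2.const_mul c, h.3.const_mul c, h.4.const_mul c, h.5.const_mul c⟩

lemma zero : IsH2 U (fun _ => 0) (fun _ => 0) (fun _ => 0) :=
  have h : IsPrim (fun _ => 0) (fun _ => 0) :=
    IsPrim.of_hasDerivAt (fun x => hasDerivAt_const x 0) continuous_const
  ⟨h, h, MemLp.zero', MemLp.zero', MemLp.zero'⟩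

lemma hasWeakDeriv (h : IsH2 U u g k) : HasWeakDeriv U (h.memLp.toLp u) (h.memLp'.toLp g) :=
  h.prim.hasWeakDeriv U _ _

lemma hasWeakDeriv' (h : IsH2 U u g k) : HasWeakDeriv U (h.memLp'.toLp g) (h.memLp''.toLp k) :=
  h.prim'.hasWeakDeriv U _ _

lemma hasTrace (h : IsH2 U u g k) (x : ℝ) : HasTrace U (h.memLp.toLp u) x (u x) :=
  ⟨u, h.prim.continuous.continuousOn, h.memLp.coeFn_toLp, rfl⟩

lemma hasTrace_weakDeriv (hU : IsOpen U) (h : IsH2 U u g k) (x : ℝ) :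
    HasTrace U (weakDeriv U (h.memLp.toLp u)) x (g x) := by
  rw [h.hasWeakDeriv.weakDeriv_eq hU]
  exact ⟨g, h.prim'.continuous.continuousOn, h.memLp'.coeFn_toLp, rfl⟩

end IsH2

variable {L γ : ℝ}

/-- Resolvent solutions, eigenfunctions and the Weyl sequence all enter the domain through this
lemma. Representatives live on the whole line, so the vertex conditions are equations between point
values. -/
lemma exists_mem_domain {u g k u' g' k' : ℝ → ℂ} (hc : IsH2 (loop L) u g k)
    (hh : IsH2 tail u' g' k') (h1 : u L = u' 0) (h2 : u (-L) = u' 0)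
    (h3 : g (-L) - g L + g' 0 = γ * u' 0) :
    ∃ v : (deltaLaplacian L γ).domain,
      (v : L2Tadpole L) = WithLp.toLp 2 (hc.memLp.toLp u, hh.memLp.toLp u') ∧
      deltaLaplacian L γ v = WithLp.toLp 2 (-hc.memLp''.toLp k, -hh.memLp''.toLp k') := by
  refine ⟨⟨WithLp.toLp 2 (hc.memLp.toLp u, hh.memLp.toLp u'), ?_⟩, rfl, ?_⟩
  · refine ⟨⟨_, _, hc.hasWeakDeriv, hc.hasWeakDeriv'⟩, ⟨_, _, hh.hasWeakDeriv, hh.hasWeakDeriv'⟩,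
      u' 0, g (-L), g L, g' 0, ?_, ?_, hh.hasTrace 0,
      hc.hasTrace_weakDeriv isOpen_Ioo _, hc.hasTrace_weakDeriv isOpen_Ioo _,
      hh.hasTrace_weakDeriv isOpen_Ioi _, h3⟩
    · rw [← h1]; exact hc.hasTrace L
    · rw [← h2]; exact hc.hasTrace (-L)
  · change WithLp.toLp 2 (-weakDeriv (loop L) (weakDeriv (loop L) (hc.memLp.toLp u)),
          -weakDeriv tail (weakDeriv tail (hh.memLp.toLp u'))) = _
    rw [hc.hasWeakDeriv.weakDeriv_eq isOpen_Ioo, hc.hasWeakDeriv'.weakDeriv_eq isOpen_Ioo,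
      hh.hasWeakDeriv.weakDeriv_eq isOpen_Ioi, hh.hasWeakDeriv'.weakDeriv_eq isOpen_Ioi]

/-- Weak solutions of `f'' = κ² f` are combinations of exponentials. -/
lemma exists_ae_eq_exp_add_exp {U : Set ℝ} (hU : IsOpen U) (hc : U.OrdConnected)
    (hne : U.Nonempty) {κ : ℂ} (hκ : κ ≠ 0) {f g : L2 U} (h1 : HasWeakDeriv U f g)
    (h2 : HasWeakDeriv U g (κ ^ 2 • f)) : ∃ A B : ℂ,
      f =ᵐ[volume.restrict U]
        (fun x => A * Complex.exp (κ * x) + B * Complex.exp (-κ * x)) ∧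
      g =ᵐ[volume.restrict U]
        (fun x => κ * A * Complex.exp (κ * x) - κ * B * Complex.exp (-κ * x)) := by
  -- Factorisation of `d²/dx² - κ²`: for `ν = ±κ` the combination `f' + ν f` solves the first-order
  -- equation `w' = ν w`. The two combinations determine `f` and `f'`.
  have key : ∀ ν : ℂ, ν ^ 2 = κ ^ 2 → ∃ c : ℂ, (fun x => g x + ν * f x) =ᵐ[volume.restrict U]
      fun x => c * Complex.exp (ν * x) := by
    intro ν hν
    have h : HasWeakDeriv U (g + ν • f) (ν • (g + ν • f)) := by
      have := h2.add (h1.smul ν)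
      rwa [show κ ^ 2 • f + ν • g = ν • (g + ν • f) by rw [← hν]; module] at this
    obtain ⟨c, hc⟩ := h.exists_ae_eq_exp hU hc hne
    refine ⟨c, ?_⟩
    filter_upwards [hc, Lp.coeFn_add g (ν • f), Lp.coeFn_smul ν f] with x e1 e2 e3
    rw [← e1, e2, Pi.add_apply, e3, Pi.smul_apply, smul_eq_mul]
  obtain ⟨c, hc⟩ := key κ rfl
  obtain ⟨d, hd⟩ := key (-κ) (by ring)
  refine ⟨c / (2 * κ), -d / (2 * κ), ?_, ?_⟩
  · filter_upwards [hc, hd] with x e1 e2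
    generalize Complex.exp (-κ * x) = y at *
    field_simp
    linear_combination e1 - e2
  · filter_upwards [hc, hd] with x e1 e2
    generalize Complex.exp (-κ * x) = y at *
    field_simp
    linear_combination e1 + e2

/-- The exponential has modulus at least one on the tail, so the constant `c` itself would be in
`L²` of a set of infinite measure. -/
lemma eq_zero_of_memLp_exp {κ c : ℂ} (hκ : 0 < κ.re)
    (h : MemLp (fun x : ℝ => c * Complex.exp (κ * x)) 2 (volume.restrict tail)) : c = 0 := by
  have h1 : MemLp (fun _ : ℝ => c) 2 (volume.restrict tail) := by
    refine h.mono aestronglyMeasurable_const ?_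
    filter_upwards [ae_restrict_mem measurableSet_Ioi] with x hx
    rw [norm_mul, Complex.norm_exp]
    refine le_mul_of_one_le_right (norm_nonneg _) (Real.one_le_exp ?_)
    simp only [Complex.mul_re, Complex.ofReal_re, Complex.ofReal_im, mul_zero, sub_zero]
    exact (mul_pos hκ hx).le
  rw [memLp_const_iff (by norm_num) (by norm_num)] at h1
  simpa using h1

lemma memLp_loop {f : ℝ → ℂ} (hf : Continuous f) : MemLp f 2 (volume.restrict (loop L)) := by
  obtain ⟨C, hC⟩ := isCompact_Icc.exists_bound_of_continuousOn (s := Icc (-L) L) hf.continuousOn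
  refine MemLp.of_bound hf.aestronglyMeasurable C ?_
  filter_upwards [ae_restrict_mem measurableSet_Ioo] with x hx
  exact hC x (Ioo_subset_Icc_self hx)

lemma memLp_tail_exp {κ : ℂ} (hκ : 0 < κ.re) :
    MemLp (fun x : ℝ => Complex.exp (-κ * x)) 2 (volume.restrict tail) := by
  have hc := (contDiff_cexp_mul (-κ)).continuous
  rw [memLp_two_iff_integrable_sq_norm hc.aestronglyMeasurable]
  refine (integrableOn_exp_mul_Ioi (a := -(2 * κ.re)) (by linarith) 0).congr_fun (fun x _ => ?_)
    measurableSet_Ioi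
  simp only
  rw [Complex.norm_exp, ← Real.exp_nat_mul]
  congr 1
  simp; ring

lemma isH2_exp {κ : ℂ} (hκ : 0 < κ.re) :
    IsH2 tail (fun x => Complex.exp (-κ * x)) (fun x => -κ * Complex.exp (-κ * x))
      (fun x => κ ^ 2 * Complex.exp (-κ * x)) := by
  have hp : IsPrim (fun x : ℝ => Complex.exp (-κ * x)) (fun x => -κ * Complex.exp (-κ * x)) :=
    IsPrim.of_hasDerivAt (hasDerivAt_cexp_mul (-κ))
      (continuous_const.mul (contDiff_cexp_mul (-κ)).continuous)
  have hm := memLp_tail_exp hκ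
  exact ⟨hp, (hp.const_mul (-κ)).congr_right fun x => by ring, hm, hm.const_mul _, hm.const_mul _⟩

lemma hasDerivAt_ccosh_mul (κ : ℂ) (x : ℝ) :
    HasDerivAt (fun x : ℝ => Complex.cosh (κ * x)) (κ * Complex.sinh (κ * x)) x := by
  have h : HasDerivAt (fun x : ℂ => κ * x) (κ * 1) x := (hasDerivAt_id (x : ℂ)).const_mul κ
  convert h.ccosh.comp_ofReal using 1
  ring

lemma hasDerivAt_csinh_mul (κ : ℂ) (x : ℝ) :
    HasDerivAt (fun x : ℝ => Complex.sinh (κ * x)) (κ * Complex.cosh (κ * x)) x := by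
  have h : HasDerivAt (fun x : ℂ => κ * x) (κ * 1) x := (hasDerivAt_id (x : ℂ)).const_mul κ
  convert h.csinh.comp_ofReal using 1
  ring

lemma continuous_ccosh_mul (κ : ℂ) : Continuous fun x : ℝ => Complex.cosh (κ * x) :=
  continuous_iff_continuousAt.2 fun x => (hasDerivAt_ccosh_mul κ x).continuousAt

lemma continuous_csinh_mul (κ : ℂ) : Continuous fun x : ℝ => Complex.sinh (κ * x) :=
  continuous_iff_continuousAt.2 fun x => (hasDerivAt_csinh_mul κ x).continuousAt

lemma isH2_cosh (κ : ℂ) :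
    IsH2 (loop L) (fun x => Complex.cosh (κ * x)) (fun x => κ * Complex.sinh (κ * x))
      (fun x => κ ^ 2 * Complex.cosh (κ * x)) := by
  have c1 := continuous_ccosh_mul κ
  have c2 := continuous_csinh_mul κ
  refine ⟨IsPrim.of_hasDerivAt (hasDerivAt_ccosh_mul κ) (continuous_const.mul c2),
    ((IsPrim.of_hasDerivAt (hasDerivAt_csinh_mul κ) (continuous_const.mul c1)).const_mul
      κ).congr_right fun x => by ring, memLp_loop c1, memLp_loop (continuous_const.mul c2),
      memLp_loop (continuous_const.mul c1)⟩

lemma isH2_sinh (κ : ℂ) :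
    IsH2 (loop L) (fun x => Complex.sinh (κ * x)) (fun x => κ * Complex.cosh (κ * x))
      (fun x => κ ^ 2 * Complex.sinh (κ * x)) := by
  have c1 := continuous_ccosh_mul κ
  have c2 := continuous_csinh_mul κ
  refine ⟨IsPrim.of_hasDerivAt (hasDerivAt_csinh_mul κ) (continuous_const.mul c1),
    ((IsPrim.of_hasDerivAt (hasDerivAt_ccosh_mul κ) (continuous_const.mul c2)).const_mul
      κ).congr_right fun x => by ring, memLp_loop c2, memLp_loop (continuous_const.mul c1),
      memLp_loop (continuous_const.mul c2)⟩

end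

/-! ### Eigenfunctions and the resolvent -/

section

variable {L γ : ℝ} {κ : ℂ}

/-- A zero would force `exp w` and `exp (-w)` to have equal modulus, that is `re w = 0`. -/
lemma csinh_ne_zero {w : ℂ} (hw : 0 < w.re) : Complex.sinh w ≠ 0 := by
  intro h
  have h1 : Complex.exp w = Complex.exp (-w) := by
    rw [Complex.sinh] at h
    linear_combination 2 * h
  have h2 := congrArg norm h1
  rw [Complex.norm_exp, Complex.norm_exp, Real.exp_eq_exp, Complex.neg_re] at h2
  linarith

lemma ccosh_ne_zero {w : ℂ} (hw : 0 < w.re) : Complex.cosh w ≠ 0 := by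
  intro h
  have h1 : Complex.exp w = -Complex.exp (-w) := by
    rw [Complex.cosh] at h
    linear_combination 2 * h
  have h2 := congrArg norm h1
  rw [norm_neg, Complex.norm_exp, Complex.norm_exp, Real.exp_eq_exp, Complex.neg_re] at h2
  linarith

/-- The characteristic function: its zeros `κ` with `0 < re κ` give the eigenvalues `-κ²`. -/
def charFn (L γ : ℝ) (κ : ℂ) : ℂ :=
  2 * κ * Complex.sinh (κ * L) + (γ + κ) * Complex.cosh (κ * L)

lemma mul_re_pos (hL : 0 < L) (hκ : 0 < κ.re) : 0 < (κ * L).re := by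
  simpa using mul_pos hκ hL

/-- Each condition removes one freedom: integrability kills the growing exponential on the tail,
`v_c(L) = v_c(-L)` the odd part on the loop, and continuity at the vertex fixes the tail amplitude.
What is left of the delta condition is the last equation. -/
lemma eigenfunction_form (hL : 0 < L) (hκ : 0 < κ.re) (v : (deltaLaplacian L γ).domain)
    (hv : deltaLaplacian L γ v = (-κ ^ 2) • (v : L2Tadpole L)) : ∃ A : ℂ,
      (v : L2Tadpole L).fst =ᵐ[volume.restrict (loop L)]
        (fun x => A * Complex.cosh (κ * x)) ∧
      (v : L2Tadpole L).snd =ᵐ[volume.restrict tail]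
        (fun x => A * (Complex.cosh (κ * L) * Complex.exp (-κ * x))) ∧
      A * charFn L γ κ = 0 := by
  have hκ0 : κ ≠ 0 := fun h => by simp [h] at hκ
  obtain ⟨⟨v, hvd⟩, rfl⟩ : ∃ w : (deltaLaplacian L γ).domain, w = v := ⟨v, rfl⟩
  obtain ⟨⟨g, k, hg, hk⟩, ⟨g', k', hg', hk'⟩, a, p, q, r, t1, t2, t3, t4, t5, t6, t7⟩ := hvd
  have e1 : -weakDeriv (loop L) (weakDeriv (loop L) v.fst) = (-κ ^ 2) • v.fst :=
    congrArg WithLp.fst hv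
  have e2 : -weakDeriv tail (weakDeriv tail v.snd) = (-κ ^ 2) • v.snd :=
    congrArg WithLp.snd hv
  rw [hg.weakDeriv_eq isOpen_Ioo, hk.weakDeriv_eq isOpen_Ioo, neg_smul, neg_inj] at e1
  rw [hg'.weakDeriv_eq isOpen_Ioi, hk'.weakDeriv_eq isOpen_Ioi, neg_smul, neg_inj] at e2
  rw [hg.weakDeriv_eq isOpen_Ioo] at t4 t5
  rw [hg'.weakDeriv_eq isOpen_Ioi] at t6
  rw [e1] at hk
  rw [e2] at hk'
  obtain ⟨A, B, hf, hfg⟩ := exists_ae_eq_exp_add_exp isOpen_Ioo ordConnected_Ioo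
    (nonempty_Ioo.2 (by linarith)) hκ0 hg hk
  obtain ⟨A', C, hf', hfg'⟩ := exists_ae_eq_exp_add_exp isOpen_Ioi ordConnected_Ioi
    nonempty_Ioi hκ0 hg' hk'
  have hA' : A' = 0 := by
    -- The combination `v_h' + κ v_h` is in `L²` and isolates the growing exponential.
    have hm : MemLp (fun x : ℝ => (2 * κ * A') * Complex.exp (κ * x)) 2
        (volume.restrict tail) := by
      refine (memLp_congr_ae ?_).1 ((Lp.memLp g').add ((Lp.memLp v.snd).const_mul κ))
      filter_upwards [hf', hfg'] with x k1 k2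
      simp only [Pi.add_apply]
      rw [k1, k2]; ring
    have := eq_zero_of_memLp_exp hκ hm
    simpa [hκ0] using this
  subst hA'
  have cE : ∀ (ν : ℂ), Continuous fun x : ℝ => Complex.exp (ν * x) := fun ν =>
    (contDiff_cexp_mul ν).continuous
  have cu : Continuous fun x : ℝ => A * Complex.exp (κ * x) + B * Complex.exp (-κ * x) :=
    (continuous_const.mul (cE κ)).add (continuous_const.mul (cE (-κ)))
  have cg : Continuous fun x : ℝ =>
      κ * A * Complex.exp (κ * x) - κ * B * Complex.exp (-κ * x) :=
    (continuous_const.mul (cE κ)).sub (continuous_const.mul (cE (-κ)))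
  have cu' : Continuous fun x : ℝ => 0 * Complex.exp (κ * x) + C * Complex.exp (-κ * x) :=
    (continuous_const.mul (cE κ)).add (continuous_const.mul (cE (-κ)))
  have cg' : Continuous fun x : ℝ =>
      κ * 0 * Complex.exp (κ * x) - κ * C * Complex.exp (-κ * x) :=
    (continuous_const.mul (cE κ)).sub (continuous_const.mul (cE (-κ)))
  have hcl : closure (loop L) = Icc (-L) L := closure_Ioo (by linarith)
  have m1 : L ∈ closure (loop L) := by rw [hcl]; constructor <;> linarith
  have m2 : -L ∈ closure (loop L) := by rw [hcl]; constructor <;> linarith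
  have m3 : (0 : ℝ) ∈ closure tail := by rw [closure_Ioi]; exact self_mem_Ici
  have s1 := t1.eq_of_ae_eq isOpen_Ioo m1 cu hf
  have s2 := t2.eq_of_ae_eq isOpen_Ioo m2 cu hf
  have s3 := t3.eq_of_ae_eq isOpen_Ioi m3 cu' hf'
  have s4 := t4.eq_of_ae_eq isOpen_Ioo m2 cg hfg
  have s5 := t5.eq_of_ae_eq isOpen_Ioo m1 cg hfg
  have s6 := t6.eq_of_ae_eq isOpen_Ioi m3 cg' hfg'
  have x1 : Complex.exp (κ * ((-L : ℝ) : ℂ)) = Complex.exp (-(κ * L)) := by congr 1; simp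
  have x2 : Complex.exp (-κ * ((-L : ℝ) : ℂ)) = Complex.exp (κ * L) := by congr 1; simp
  have x3 : Complex.exp (-κ * L) = Complex.exp (-(κ * L)) := by congr 1; simp
  simp only [x1, x2, x3, Complex.ofReal_zero, mul_zero, Complex.exp_zero, zero_add,
    mul_one, zero_sub] at s1 s2 s3 s4 s5 s6
  have hs := csinh_ne_zero (mul_re_pos hL hκ)
  have hAB : A = B := by
    have : (A - B) * Complex.sinh (κ * L) = 0 := by
      rw [Complex.sinh]
      linear_combination (1 / 2) * (s2 - s1)
    exact sub_eq_zero.1 ((mul_eq_zero.1 this).resolve_right hs)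
  subst hAB
  have hC : C = 2 * A * Complex.cosh (κ * L) := by
    rw [Complex.cosh]
    linear_combination s1 - s3
  refine ⟨2 * A, ?_, ?_, ?_⟩
  · filter_upwards [hf] with x hx
    rw [hx, Complex.cosh, neg_mul]
    ring
  · filter_upwards [hf'] with x hx
    rw [hx, hC]
    ring
  · rw [s4, s5, s6, s1] at t7
    rw [hC] at t7
    rw [charFn, Complex.sinh, Complex.cosh]
    rw [Complex.cosh] at t7
    linear_combination -t7

/-- The weak equation `u'' = κ² u - F` on an open set has solutions with uniform bounds. -/
lemma exists_isH2_green {U : Set ℝ} (hU : IsOpen U) (hκ : 0 < κ.re) : ∃ C : ℝ, 0 ≤ C ∧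
    ∀ F : L2 U, ∃ u g k : ℝ → ℂ, ∃ h : IsH2 U u g k, (∀ x, ‖u x‖ ≤ C * ‖F‖) ∧
      (∀ x, ‖g x‖ ≤ C * ‖F‖) ∧ ‖h.memLp.toLp u‖ ≤ C * ‖F‖ ∧
      h.memLp''.toLp k = κ ^ 2 • h.memLp.toLp u - F := by
  obtain ⟨C, hC⟩ := exists_isPrim_green hκ
  refine ⟨C, C.2, fun F => ?_⟩
  -- `F` is extended by zero, so that the Green function of the whole line serves both edges.
  have hFm : Measurable (U.indicator F) :=
    (Lp.stronglyMeasurable F).measurable.indicator hU.measurableSet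
  have hF2 : MemLp (U.indicator F) 2 :=
    (memLp_indicator_iff_restrict hU.measurableSet).2 (Lp.memLp F)
  have hFn : eLpNorm (U.indicator F) 2 volume = ‖F‖ₑ := by
    rw [eLpNorm_indicator_eq_eLpNorm_restrict hU.measurableSet, Lp.enorm_def]
  obtain ⟨u, g, h1, h2, b1, b2, b3, b4⟩ := hC _ hFm hF2
  rw [hFn] at b1 b2 b3 b4
  have hfin : (C : ENNReal) * ‖F‖ₑ < ⊤ := by finiteness
  have mu : MemLp u 2 := ⟨h1.continuous.aestronglyMeasurable, b3.trans_lt hfin⟩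
  have mg : MemLp g 2 := ⟨h2.continuous.aestronglyMeasurable, b4.trans_lt hfin⟩
  have mk : MemLp (fun x => κ ^ 2 * u x - U.indicator F x) 2 := (mu.const_mul _).sub hF2
  have toR : ∀ y : ℂ, ‖y‖ₑ ≤ C * ‖F‖ₑ → ‖y‖ ≤ C * ‖F‖ := fun y hy => by
    have := ENNReal.toReal_mono hfin.ne hy
    simpa using this
  have h : IsH2 U u g (fun x => κ ^ 2 * u x - U.indicator F x) :=
    ⟨h1, h2, mu.restrict U, mg.restrict U, mk.restrict U⟩
  refine ⟨u, g, _, h, fun x => toR _ (b1 x), fun x => toR _ (b2 x), ?_, ?_⟩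
  · rw [Lp.norm_toLp]
    have := ENNReal.toReal_mono hfin.ne
      ((eLpNorm_mono_measure u (Measure.restrict_le_self (s := U))).trans b3)
    simpa using this
  · refine Lp.ext ?_
    filter_upwards [h.memLp''.coeFn_toLp, Lp.coeFn_sub (κ ^ 2 • h.memLp.toLp u) F,
      Lp.coeFn_smul (κ ^ 2) (h.memLp.toLp u), h.memLp.coeFn_toLp,
      ae_restrict_mem hU.measurableSet] with x y1 y2 y3 y4 y5
    rw [y1, y2, Pi.sub_apply, y3, Pi.smul_apply, y4, smul_eq_mul, indicator_of_mem y5]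

lemma norm_toLp_prod_le {U V : Set ℝ} (f : L2 U) (g : L2 V) :
    ‖WithLp.toLp 2 (f, g)‖ ≤ ‖f‖ + ‖g‖ := by
  rw [WithLp.prod_norm_eq_of_L2]
  refine Real.sqrt_le_iff.2 ⟨by positivity, ?_⟩
  have := mul_nonneg (norm_nonneg f) (norm_nonneg g)
  change ‖f‖ ^ 2 + ‖g‖ ^ 2 ≤ _
  nlinarith

/-- The edgewise Green solutions are corrected by `A cosh + B sinh` on the loop and `C exp (-κ x)`
on the tail. The vertex conditions are a linear system for `A`, `B`, `C` with pivots `2 sinh (κ L)`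
and `charFn L γ κ`, and the uniform bounds on the Green solutions bound the coefficients. -/
lemma exists_resolvent_solution (hL : 0 < L) (hκ : 0 < κ.re) (hD : charFn L γ κ ≠ 0) :
    ∃ K : ℝ, ∀ f : L2Tadpole L, ∃ v : (deltaLaplacian L γ).domain,
      deltaLaplacian L γ v - (-κ ^ 2) • (v : L2Tadpole L) = f ∧
      ‖(v : L2Tadpole L)‖ ≤ K * ‖f‖ := by
  obtain ⟨C₁, hC₁, G₁⟩ := exists_isH2_green (U := loop L) isOpen_Ioo hκ
  obtain ⟨C₂, hC₂, G₂⟩ := exists_isH2_green (U := tail) isOpen_Ioi hκ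
  have hs := csinh_ne_zero (mul_re_pos hL hκ)
  set sh := Complex.sinh (κ * L) with hsh
  set ch := Complex.cosh (κ * L) with hch
  set D := charFn L γ κ with hDdef
  have hDe : D = 2 * κ * sh + (γ + κ) * ch := rfl
  have H1 := isH2_cosh (L := L) κ
  have H2 := isH2_sinh (L := L) κ
  have H3 := isH2_exp hκ
  set c₁ := ‖(2 * sh)⁻¹‖ * (C₁ + C₁)
  set c₂ := ‖D⁻¹‖ * (C₁ + C₁ + C₂ + ‖κ‖ * C₂ + ‖γ + κ‖ * (C₁ + c₁ * ‖sh‖))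
  set c₃ := C₁ + c₂ * ‖ch‖ + c₁ * ‖sh‖ + C₂
  refine ⟨C₁ + c₂ * ‖H1.memLp.toLp‖ + c₁ * ‖H2.memLp.toLp‖ +
    (C₂ + c₃ * ‖H3.memLp.toLp‖), fun f => ?_⟩
  obtain ⟨u, g, k, hu, bu, bg, bL, ek⟩ := G₁ f.fst
  obtain ⟨w, g', k', hw, bw, bg', bL', ek'⟩ := G₂ f.snd
  have n1 : ‖f.fst‖ ≤ ‖f‖ := WithLp.norm_fst_le _ f
  have n2 : ‖f.snd‖ ≤ ‖f‖ := WithLp.norm_snd_le _ f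
  have bu := fun x => (bu x).trans (mul_le_mul_of_nonneg_left n1 hC₁)
  have bg := fun x => (bg x).trans (mul_le_mul_of_nonneg_left n1 hC₁)
  have bw := fun x => (bw x).trans (mul_le_mul_of_nonneg_left n2 hC₂)
  have bg' := fun x => (bg' x).trans (mul_le_mul_of_nonneg_left n2 hC₂)
  have bL := bL.trans (mul_le_mul_of_nonneg_left n1 hC₁)
  have bL' := bL'.trans (mul_le_mul_of_nonneg_left n2 hC₂)
  set N := ‖f‖
  -- `B` equalises the two end values on the loop, `C` matches the tail to them, and `A` comes from
  -- the delta condition after `C` is eliminated.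
  obtain ⟨B, hB⟩ : ∃ B, B = (2 * sh)⁻¹ * (u (-L) - u L) := ⟨_, rfl⟩
  obtain ⟨A, hA⟩ : ∃ A, A = D⁻¹ * (g (-L) - g L + g' 0 + κ * w 0 - (γ + κ) * (u L + B * sh)) :=
    ⟨_, rfl⟩
  obtain ⟨C, hC⟩ : ∃ C, C = u L + A * ch + B * sh - w 0 := ⟨_, rfl⟩
  have bB : ‖B‖ ≤ c₁ * N := by
    rw [hB, norm_mul, mul_assoc]
    gcongr
    calc _ ≤ ‖u (-L)‖ + ‖u L‖ := norm_sub_le _ _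
      _ ≤ C₁ * N + C₁ * N := add_le_add (bu _) (bu _)
      _ = _ := by ring
  have bA : ‖A‖ ≤ c₂ * N := by
    rw [hA, norm_mul, mul_assoc]
    gcongr
    calc _ ≤ ‖g (-L)‖ + ‖g L‖ + ‖g' 0‖ + ‖κ‖ * ‖w 0‖ + ‖γ + κ‖ * (‖u L‖ + ‖B‖ * ‖sh‖) := by
          refine (norm_sub_le _ _).trans (add_le_add ((norm_add_le _ _).trans (add_le_add
            ((norm_add_le _ _).trans (add_le_add (norm_sub_le _ _) le_rfl)) (norm_mul _ _).le)) ?_)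
          rw [norm_mul]
          gcongr
          exact (norm_add_le _ _).trans (add_le_add le_rfl (norm_mul _ _).le)
      _ ≤ C₁ * N + C₁ * N + C₂ * N + ‖κ‖ * (C₂ * N) + ‖γ + κ‖ * (C₁ * N + c₁ * N * ‖sh‖) := by
          gcongr
          exacts [bg _, bg _, bg' _, bw _, bu _]
      _ = _ := by ring
  have bC : ‖C‖ ≤ c₃ * N := by
    rw [hC]
    calc _ ≤ ‖u L‖ + ‖A‖ * ‖ch‖ + ‖B‖ * ‖sh‖ + ‖w 0‖ := by
          refine (norm_sub_le _ _).trans (add_le_add ((norm_add_le _ _).trans (add_le_add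
            ((norm_add_le _ _).trans (add_le_add le_rfl (norm_mul _ _).le)) (norm_mul _ _).le))
            le_rfl)
      _ ≤ C₁ * N + c₂ * N * ‖ch‖ + c₁ * N * ‖sh‖ + C₂ * N := by
          gcongr
          exacts [bu _, bw _]
      _ = _ := by ring
  have hc := (hu.add (H1.const_mul A)).add (H2.const_mul B)
  have hh := hw.add (H3.const_mul C)
  have cm : Complex.cosh (κ * ((-L : ℝ) : ℂ)) = ch := by
    rw [Complex.ofReal_neg, mul_neg, Complex.cosh_neg]
  have sm : Complex.sinh (κ * ((-L : ℝ) : ℂ)) = -sh := by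
    rw [Complex.ofReal_neg, mul_neg, Complex.sinh_neg]
  have hB2 : 2 * B * sh = u (-L) - u L := by rw [hB]; field_simp
  have hA2 : A * D = g (-L) - g L + g' 0 + κ * w 0 - (γ + κ) * (u L + B * sh) := by
    rw [hA]; field_simp
  obtain ⟨v, hv, hTv⟩ := exists_mem_domain (γ := γ) hc hh
    (by
      simp only [← hsh, ← hch, Complex.ofReal_zero, mul_zero, Complex.exp_zero, mul_one]
      rw [hC]; ring)
    (by
      simp only [cm, sm, Complex.ofReal_zero, mul_zero, Complex.exp_zero, mul_one]
      rw [hC]; linear_combination -hB2)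
    (by
      simp only [cm, sm, ← hsh, ← hch, Complex.ofReal_zero, mul_zero, Complex.exp_zero, mul_one]
      rw [hDe] at hA2
      rw [hC]; linear_combination -hA2)
  have e1 : hc.memLp.toLp _ = hu.memLp.toLp u + A • H1.memLp.toLp _ + B • H2.memLp.toLp _ := rfl
  have e2 : hh.memLp.toLp _ = hw.memLp.toLp w + C • H3.memLp.toLp _ := rfl
  refine ⟨v, ?_, ?_⟩
  · have q1 : H1.memLp''.toLp _ = κ ^ 2 • H1.memLp.toLp _ := rfl
    have q2 : H2.memLp''.toLp _ = κ ^ 2 • H2.memLp.toLp _ := rfl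
    have q3 : H3.memLp''.toLp _ = κ ^ 2 • H3.memLp.toLp _ := rfl
    have e3 : hc.memLp''.toLp _ =
      hu.memLp''.toLp k + A • H1.memLp''.toLp _ + B • H2.memLp''.toLp _ := rfl
    have e4 : hh.memLp''.toLp _ = hw.memLp''.toLp k' + C • H3.memLp''.toLp _ := rfl
    rw [hTv, hv, e1, e2, e3, e4, ek, ek', q1, q2, q3]
    apply WithLp.ofLp_injective
    refine Prod.ext ?_ ?_
    · have alg : ∀ x y a b : L2 (loop L), -(κ ^ 2 • x - y + A • κ ^ 2 • a + B • κ ^ 2 • b) -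
          (-κ ^ 2) • (x + A • a + B • b) = y := fun x y a b => by module
      exact alg _ f.fst _ _
    · have alg : ∀ x y a : L2 tail, -(κ ^ 2 • x - y + C • κ ^ 2 • a) -
          (-κ ^ 2) • (x + C • a) = y := fun x y a => by module
      exact alg _ f.snd _
  · rw [hv, e1, e2]
    refine (norm_toLp_prod_le _ _).trans ?_
    have b1 : ‖hu.memLp.toLp u + A • H1.memLp.toLp _ + B • H2.memLp.toLp _‖ ≤
        C₁ * N + c₂ * N * ‖H1.memLp.toLp‖ + c₁ * N * ‖H2.memLp.toLp‖ := by
      refine (norm_add₃_le).trans ?_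
      rw [norm_smul, norm_smul]
      gcongr
    have b2 : ‖hw.memLp.toLp w + C • H3.memLp.toLp _‖ ≤ C₂ * N + c₃ * N * ‖H3.memLp.toLp‖ := by
      refine (norm_add_le _ _).trans ?_
      rw [norm_smul]
      gcongr
    refine (add_le_add b1 b2).trans (le_of_eq ?_)
    ring

end

/-! ### The Weyl sequence, resolvent points and eigenvalues -/

section

variable {L γ : ℝ} {κ : ℂ}

lemma integral_pow_mul_exp_neg (m : ℕ) {r : ℝ} (hr : 0 < r) :
    ∫ x in tail, x ^ m * Real.exp (-(r * x)) = m.factorial / r ^ (m + 1) := by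
  have h := Real.integral_rpow_mul_exp_neg_mul_Ioi (a := m + 1) (by positivity) hr
  rw [Real.Gamma_nat_eq_factorial] at h
  have e : ∀ x : ℝ, x ^ ((m : ℝ) + 1 - 1) = x ^ m := fun x => by simp
  simp only [e] at h
  rw [h]
  have : (1 / r) ^ ((m : ℝ) + 1) = (1 / r) ^ (m + 1) := by
    rw [← Real.rpow_natCast]; simp
  rw [this, one_div, inv_pow, div_eq_inv_mul]

lemma norm_pow_mul_exp_sq (n : ℕ) (κ : ℂ) (x : ℝ) :
    ‖(x : ℂ) ^ n * Complex.exp (-κ * x)‖ ^ 2 = x ^ (2 * n) * Real.exp (-(2 * κ.re * x)) := by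
  rw [norm_mul, norm_pow, Complex.norm_real, Complex.norm_exp, mul_pow, ← pow_mul, mul_comm n,
    pow_mul, Real.norm_eq_abs, sq_abs, ← pow_mul, ← Real.exp_nat_mul]
  congr 2
  simp
  ring

lemma continuous_pow_mul_exp (n : ℕ) (κ : ℂ) :
    Continuous fun x : ℝ => (x : ℂ) ^ n * Complex.exp (-κ * x) :=
  (Complex.continuous_ofReal.pow n).mul (contDiff_cexp_mul (-κ)).continuous

lemma memLp_pow_mul_exp (n : ℕ) (hκ : 0 < κ.re) :
    MemLp (fun x : ℝ => (x : ℂ) ^ n * Complex.exp (-κ * x)) 2 (volume.restrict tail) := by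
  rw [memLp_two_iff_integrable_sq_norm (continuous_pow_mul_exp n κ).aestronglyMeasurable]
  simp only [norm_pow_mul_exp_sq]
  refine Integrable.of_integral_ne_zero ?_
  rw [integral_pow_mul_exp_neg _ (by positivity)]
  positivity

lemma norm_toLp_pow_mul_exp_sq (n : ℕ) (hκ : 0 < κ.re) :
    ‖(memLp_pow_mul_exp n hκ).toLp‖ ^ 2 = (2 * n).factorial / (2 * κ.re) ^ (2 * n + 1) := by
  have e : ∫ x in tail, ‖(x : ℂ) ^ n * Complex.exp (-κ * x)‖ ^ (2 : ℝ) =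
      (2 * n).factorial / (2 * κ.re) ^ (2 * n + 1) := by
    rw [← integral_pow_mul_exp_neg _ (by positivity)]
    simp only [Real.rpow_two, norm_pow_mul_exp_sq]
  rw [Lp.norm_toLp,
    (memLp_pow_mul_exp n hκ).eLpNorm_eq_integral_rpow_norm (by norm_num) (by norm_num),
    ENNReal.toReal_ofNat, e, ENNReal.toReal_ofReal (by positivity), ← Real.rpow_natCast,
    ← Real.rpow_mul (by positivity)]
  norm_num

/-- The factor `x ^ 2` makes the function and its derivative vanish at `0`. Paired with zero on the
loop, it satisfies the vertex condition for every `γ`. -/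
lemma isH2_sq_mul_exp (hκ : 0 < κ.re) :
    IsH2 tail (fun x => (x : ℂ) ^ 2 * Complex.exp (-κ * x))
      (fun x => 2 * ((x : ℂ) ^ 1 * Complex.exp (-κ * x)) +
        -κ * ((x : ℂ) ^ 2 * Complex.exp (-κ * x)))
      (fun x => (2 * ((x : ℂ) ^ 0 * Complex.exp (-κ * x)) +
        -4 * κ * ((x : ℂ) ^ 1 * Complex.exp (-κ * x))) +
        κ ^ 2 * ((x : ℂ) ^ 2 * Complex.exp (-κ * x))) := by
  have c := fun n => continuous_pow_mul_exp n κ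
  have hx : ∀ x : ℝ, HasDerivAt (fun x : ℝ => (x : ℂ)) 1 x := fun x =>
    Complex.ofRealCLM.hasDerivAt
  have d1 : ∀ x : ℝ, HasDerivAt (fun x : ℝ => (x : ℂ) ^ 1 * Complex.exp (-κ * x))
      ((x : ℂ) ^ 0 * Complex.exp (-κ * x) + -κ * ((x : ℂ) ^ 1 * Complex.exp (-κ * x))) x :=
    fun x => (((hx x).fun_pow 1).mul (hasDerivAt_cexp_mul (-κ) x)).congr_deriv (by
      push_cast
      ring)
  have d2 : ∀ x : ℝ, HasDerivAt (fun x : ℝ => (x : ℂ) ^ 2 * Complex.exp (-κ * x))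
      (2 * ((x : ℂ) ^ 1 * Complex.exp (-κ * x)) + -κ * ((x : ℂ) ^ 2 * Complex.exp (-κ * x))) x :=
    fun x => (((hx x).fun_pow 2).mul (hasDerivAt_cexp_mul (-κ) x)).congr_deriv (by
      push_cast
      ring)
  have p1 := IsPrim.of_hasDerivAt d1 ((c 0).add (continuous_const.mul (c 1)))
  have p2 := IsPrim.of_hasDerivAt d2
    ((continuous_const.mul (c 1)).add (continuous_const.mul (c 2)))
  have m := fun n => memLp_pow_mul_exp n hκ
  refine ⟨p2, ((p1.const_mul 2).add (p2.const_mul (-κ))).congr_right fun x => by ring, m 2,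
    ((m 1).const_mul _).add ((m 2).const_mul _),
    (((m 0).const_mul _).add ((m 1).const_mul _)).add ((m 2).const_mul _)⟩

/-- Nonnegative numbers are in the spectrum, by a Weyl sequence on the tail. -/
lemma sq_mem_spectrum {k : ℝ} (hk : 0 ≤ k) :
    ((k ^ 2 : ℝ) : ℂ) ∈ spectrum (deltaLaplacian L γ) := by
  intro hres
  obtain ⟨K, hK⟩ := resolventSet_bound hres
  -- The Weyl functions are `x² exp (-ε x) exp (i k x)`. With `φ n` for `xⁿ exp (-κ x)`, the
  -- residual is `-(2 φ 0 - 4 κ φ 1 + (κ² + k²) φ 2)`. Its three terms are at most `8 ε`, `8 (1 + k)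
  -- ε` and `(1 + 2 k) ε` times the norm of `φ 2`, which a bounded resolvent forbids as `ε → 0`.
  have main : ∀ ε : ℝ, 0 < ε → ε ≤ 1 → 1 ≤ |K| * (ε * (8 + 8 * (1 + k) + (1 + 2 * k))) := by
    intro ε hε hε1
    set κ : ℂ := ε - Complex.I * k with hκdef
    have hre : κ.re = ε := by simp [hκdef]
    have hκ : 0 < κ.re := by rwa [hre]
    have hu := isH2_sq_mul_exp hκ
    have hz : IsH2 (loop L) (fun _ => 0) (fun _ => 0) (fun _ => 0) := IsH2.zero
    obtain ⟨v, hv, hTv⟩ := exists_mem_domain (γ := γ) hz hu (by simp) (by simp) (by simp)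
    set φ := fun n => (memLp_pow_mul_exp n hκ).toLp with hφ
    have ev : hu.memLp.toLp _ = φ 2 := rfl
    have ek : hu.memLp''.toLp _ = (2 : ℂ) • φ 0 + (-4 * κ) • φ 1 + κ ^ 2 • φ 2 := rfl
    have z1 : hz.memLp.toLp (fun _ => 0) = 0 := MemLp.toLp_zero _
    have nv : ‖φ 2‖ ≤ ‖(v : L2Tadpole L)‖ := by
      rw [hv, ev]
      exact WithLp.norm_snd_le _ (WithLp.toLp 2 (hz.memLp.toLp (fun _ => 0), φ 2))
    have hsq : κ ^ 2 + ((k ^ 2 : ℝ) : ℂ) = ε * (ε - 2 * Complex.I * k) := by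
      rw [hκdef]; push_cast
      linear_combination (k : ℂ) ^ 2 * Complex.I_sq
    have nT : ‖deltaLaplacian L γ v - ((k ^ 2 : ℝ) : ℂ) • (v : L2Tadpole L)‖ ≤
        2 * ‖φ 0‖ + 4 * ‖κ‖ * ‖φ 1‖ + ε * (ε + 2 * k) * ‖φ 2‖ := by
      have e : deltaLaplacian L γ v - ((k ^ 2 : ℝ) : ℂ) • (v : L2Tadpole L) =
          WithLp.toLp 2 (0, -((2 : ℂ) • φ 0 + (-4 * κ) • φ 1 +
            (ε * (ε - 2 * Complex.I * k)) • φ 2)) := by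
        rw [hTv, hv, ev, ek, z1, ← hsq]
        apply WithLp.ofLp_injective
        refine Prod.ext ?_ ?_
        · change -0 - ((k ^ 2 : ℝ) : ℂ) • (0 : L2 (loop L)) = 0
          simp
        · have alg : ∀ x y a : L2 tail, ∀ s : ℂ, -((2 : ℂ) • x + (-4 * κ) • y + κ ^ 2 • a) -
            s • a = -((2 : ℂ) • x + (-4 * κ) • y + (κ ^ 2 + s) • a) := fun x y a s => by module
          exact alg _ _ _ _
      rw [e]
      refine (norm_toLp_prod_le _ _).trans ?_
      rw [norm_zero, zero_add, norm_neg]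
      refine norm_add₃_le.trans ?_
      rw [norm_smul, norm_smul, norm_smul]
      have n1 : ‖(2 : ℂ)‖ = 2 := by simp
      have n2 : ‖-4 * κ‖ = 4 * ‖κ‖ := by simp
      have n3 : ‖(ε : ℂ) * (ε - 2 * Complex.I * k)‖ ≤ ε * (ε + 2 * k) := by
        rw [norm_mul, Complex.norm_real, Real.norm_of_nonneg hε.le]
        gcongr
        refine (norm_sub_le _ _).trans ?_
        simp [abs_of_pos hε, abs_of_nonneg hk]
      rw [n1, n2]
      gcongr
    have s0 : ‖φ 0‖ ^ 2 = 1 / (2 * ε) := by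
      refine (norm_toLp_pow_mul_exp_sq 0 hκ).trans ?_
      rw [hre]
      norm_num
    have s1 : ‖φ 1‖ ^ 2 = 2 / (2 * ε) ^ 3 := by
      refine (norm_toLp_pow_mul_exp_sq 1 hκ).trans ?_
      rw [hre]
      norm_num
    have s2 : ‖φ 2‖ ^ 2 = 24 / (2 * ε) ^ 5 := by
      refine (norm_toLp_pow_mul_exp_sq 2 hκ).trans ?_
      rw [hre]
      norm_num [Nat.factorial]
    -- The exact ratios of the squared norms are `16 ε⁴ / 24` here and `ε² / 3` for `φ 1`; the
    -- constants are crude.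
    have r0 : ‖φ 0‖ ≤ 4 * ε ^ 2 * ‖φ 2‖ := by
      refine le_of_sq_le_sq ?_ (by positivity)
      rw [mul_pow, s0, s2, ← sub_nonneg]
      have : (4 * ε ^ 2) ^ 2 * (24 / (2 * ε) ^ 5) - 1 / (2 * ε) = 23 / (2 * ε) := by
        field_simp; ring
      rw [this]; positivity
    have r1 : ‖φ 1‖ ≤ 2 * ε * ‖φ 2‖ := by
      refine le_of_sq_le_sq ?_ (by positivity)
      rw [mul_pow, s1, s2, ← sub_nonneg]
      have : (2 * ε) ^ 2 * (24 / (2 * ε) ^ 5) - 2 / (2 * ε) ^ 3 = 22 / (2 * ε) ^ 3 := by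
        field_simp; ring
      rw [this]; positivity
    have hpos : 0 < ‖φ 2‖ := by
      have : 0 < ‖φ 2‖ ^ 2 := by rw [s2]; positivity
      exact (norm_nonneg _).lt_of_ne' fun h => by simp [h] at this
    have nκ : ‖κ‖ ≤ 1 + k := by
      refine (norm_sub_le _ _).trans ?_
      simp only [Complex.norm_real, norm_mul, Complex.norm_I, Real.norm_eq_abs, abs_of_pos hε,
        abs_of_nonneg hk]
      linarith
    have step : ‖φ 2‖ ≤ |K| * (ε * (8 + 8 * (1 + k) + (1 + 2 * k))) * ‖φ 2‖ := by
      refine nv.trans ((hK v).trans ?_)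
      refine (mul_le_mul_of_nonneg_right (le_abs_self K) (norm_nonneg _)).trans ?_
      rw [mul_assoc]
      refine mul_le_mul_of_nonneg_left (nT.trans ?_) (abs_nonneg K)
      have t0 : 2 * ‖φ 0‖ ≤ 8 * ε * ‖φ 2‖ := by
        calc _ ≤ 2 * (4 * ε ^ 2 * ‖φ 2‖) := by gcongr
          _ = 8 * (ε * ε) * ‖φ 2‖ := by ring
          _ ≤ 8 * (ε * 1) * ‖φ 2‖ := by gcongr
          _ = _ := by ring
      have t1 : 4 * ‖κ‖ * ‖φ 1‖ ≤ 8 * (1 + k) * ε * ‖φ 2‖ := by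
        calc _ ≤ 4 * (1 + k) * (2 * ε * ‖φ 2‖) := by gcongr
          _ = _ := by ring
      have t2 : ε * (ε + 2 * k) * ‖φ 2‖ ≤ ε * (1 + 2 * k) * ‖φ 2‖ := by gcongr
      linarith
    exact le_of_mul_le_mul_right (by linarith) hpos
  set M := 8 + 8 * (1 + k) + (1 + 2 * k) with hM
  have hMpos : 0 < M := by positivity
  -- With this choice `|K| ε M = |K| / (2 (|K| + 1)) < 1`, contradicting `main`.
  set ε := 1 / (2 * (|K| + 1) * M) with hε
  have hM1 : 1 ≤ M := by rw [hM]; linarith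
  have hεpos : 0 < ε := by positivity
  have hε1 : ε ≤ 1 := by
    rw [hε, div_le_one (by positivity)]
    have := abs_nonneg K
    nlinarith
  have := main ε hεpos hε1
  have e : |K| * (ε * M) = |K| / (2 * (|K| + 1)) := by
    rw [hε]; field_simp
  rw [e, le_div_iff₀ (by positivity)] at this
  linarith [abs_nonneg K]

lemma neg_sq_mem_resolventSet (hL : 0 < L) (hκ : 0 < κ.re) (hD : charFn L γ κ ≠ 0) :
    -κ ^ 2 ∈ resolventSet (deltaLaplacian L γ) := by
  obtain ⟨K, hK⟩ := exists_resolvent_solution (γ := γ) hL hκ hD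
  refine mem_resolventSet_of_bound K hK fun v hv => ?_
  obtain ⟨A, h1, h2, h3⟩ := eigenfunction_form hL hκ v hv
  obtain rfl : A = 0 := (mul_eq_zero.1 h3).resolve_right hD
  refine Subtype.ext (WithLp.ofLp_injective 2 (Prod.ext ?_ ?_))
  · refine Lp.ext ?_
    filter_upwards [h1, Lp.coeFn_zero ℂ 2 (volume.restrict (loop L))] with x k1 k2
    refine k1.trans ?_
    rw [zero_mul]
    exact k2.symm
  · refine Lp.ext ?_
    filter_upwards [h2, Lp.coeFn_zero ℂ 2 (volume.restrict tail)] with x k1 k2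
    refine k1.trans ?_
    rw [zero_mul]
    exact k2.symm

lemma mem_eigenspace_iff {E : Type*} [NormedAddCommGroup E] [InnerProductSpace ℂ E]
    {T : E →ₗ.[ℂ] E} {z : ℂ} {v : T.domain} : v ∈ eigenspace T z ↔ T v = z • (v : E) := by
  rw [eigenspace, LinearMap.mem_ker, LinearMap.sub_apply, sub_eq_zero]
  rfl

lemma mem_spectrum_of_eigenspace_ne_bot {E : Type*} [NormedAddCommGroup E]
    [InnerProductSpace ℂ E] {T : E →ₗ.[ℂ] E} {z : ℂ} (h : eigenspace T z ≠ ⊥) :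
    z ∈ spectrum T := by
  intro hres
  obtain ⟨v, hv, hv0⟩ := (Submodule.ne_bot_iff _).1 h
  obtain ⟨K, hK⟩ := resolventSet_bound hres
  have := hK v
  rw [mem_eigenspace_iff.1 hv, sub_self, norm_zero, mul_zero] at this
  exact hv0 (Subtype.ext (norm_le_zero_iff.1 this))

/-- The pair `cosh (κ x)`, `cosh (κ L) exp (-κ x)` is an eigenfunction, and by `eigenfunction_form`
it spans the eigenspace. -/
lemma eigenspace_neg_sq (hL : 0 < L) (hκ : 0 < κ.re) (hD : charFn L γ κ = 0) :
    eigenspace (deltaLaplacian L γ) (-κ ^ 2) ≠ ⊥ ∧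
      FiniteDimensional ℂ (eigenspace (deltaLaplacian L γ) (-κ ^ 2)) := by
  have H1 := isH2_cosh (L := L) κ
  have H3 := (isH2_exp hκ).const_mul (Complex.cosh (κ * L))
  have cm : Complex.cosh (κ * ((-L : ℝ) : ℂ)) = Complex.cosh (κ * L) := by
    rw [Complex.ofReal_neg, mul_neg, Complex.cosh_neg]
  have sm : Complex.sinh (κ * ((-L : ℝ) : ℂ)) = -Complex.sinh (κ * L) := by
    rw [Complex.ofReal_neg, mul_neg, Complex.sinh_neg]
  obtain ⟨e, he, hTe⟩ := exists_mem_domain (γ := γ) H1 H3 (by simp)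
    (by rw [cm]; simp)
    (by
      simp only [sm, Complex.ofReal_zero, mul_zero, Complex.exp_zero, mul_one]
      rw [charFn] at hD
      linear_combination -hD)
  have hmem : e ∈ eigenspace (deltaLaplacian L γ) (-κ ^ 2) := by
    rw [mem_eigenspace_iff, hTe, he]
    have q1 : H1.memLp''.toLp _ = κ ^ 2 • H1.memLp.toLp _ := rfl
    have q3 : H3.memLp''.toLp _ = κ ^ 2 • H3.memLp.toLp _ := by
      rw [← MemLp.toLp_const_smul]
      refine MemLp.toLp_congr _ _ (Filter.Eventually.of_forall fun x => ?_)
      simp only [Pi.smul_apply, smul_eq_mul]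
      ring
    rw [q1, q3, neg_smul]
    rfl
  have he0 : e ≠ 0 := by
    rintro rfl
    have h0 : H1.memLp.toLp _ = 0 := (congrArg WithLp.fst he).symm
    have h1 : (fun x : ℝ => Complex.cosh (κ * x)) =ᵐ[volume.restrict (loop L)] fun _ => 0 := by
      refine H1.memLp.coeFn_toLp.symm.trans ?_
      rw [h0]
      exact Lp.coeFn_zero _ _ _
    have h2 := Measure.eqOn_open_of_ae_eq h1 isOpen_Ioo H1.prim.continuous.continuousOn
      continuousOn_const (show (0 : ℝ) ∈ loop L from ⟨by linarith, hL⟩)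
    simp at h2
  refine ⟨fun h => he0 (by simpa [h] using hmem), ?_⟩
  refine Submodule.finiteDimensional_of_le (S₂ := Submodule.span ℂ {e}) fun v hv => ?_
  obtain ⟨A, h1, h2, -⟩ := eigenfunction_form hL hκ v (mem_eigenspace_iff.1 hv)
  refine Submodule.mem_span_singleton.2 ⟨A, Subtype.ext (WithLp.ofLp_injective 2 ?_)⟩
  rw [Submodule.coe_smul, he]
  refine Prod.ext ?_ ?_
  · change A • H1.memLp.toLp _ = (v : L2Tadpole L).fst
    refine Lp.ext ?_
    filter_upwards [h1, Lp.coeFn_smul A (H1.memLp.toLp _), H1.memLp.coeFn_toLp] with x k1 k2 k3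
    rw [k1, k2, Pi.smul_apply, k3, smul_eq_mul]
  · change A • H3.memLp.toLp _ = (v : L2Tadpole L).snd
    refine Lp.ext ?_
    filter_upwards [h2, Lp.coeFn_smul A (H3.memLp.toLp _), H3.memLp.coeFn_toLp] with x k1 k2 k3
    rw [k1, k2, Pi.smul_apply, k3, smul_eq_mul]

end

/-! ### The characteristic function and the spectrum -/

variable {L γ : ℝ} {κ : ℂ}

/-- Zeros of the characteristic function in the right half-plane are real. -/
lemma im_eq_zero_of_charFn_eq_zero (hL : 0 < L) (hκ : 0 < κ.re) (h : charFn L γ κ = 0) :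
    κ.im = 0 := by
  have hch := ccosh_ne_zero (mul_re_pos hL hκ)
  set a := κ.re * L with ha
  set b := κ.im * L with hb
  have hw : κ * L = a + b * Complex.I := by
    apply Complex.ext <;> simp [ha, hb]
  have e1 : Complex.sinh (κ * L) =
      ((Real.sinh a * Real.cos b : ℝ) : ℂ) + ((Real.cosh a * Real.sin b : ℝ) : ℂ) * Complex.I := by
    rw [hw, Complex.sinh_add, Complex.cosh_mul_I, Complex.sinh_mul_I]
    push_cast; ring
  have e2 : Complex.cosh (κ * L) =
      ((Real.cosh a * Real.cos b : ℝ) : ℂ) + ((Real.sinh a * Real.sin b : ℝ) : ℂ) * Complex.I := by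
    rw [hw, Complex.cosh_add, Complex.cosh_mul_I, Complex.sinh_mul_I]
    push_cast; ring
  -- This is `|cosh (κ L)|²`.
  have hN : 0 < (Real.cosh a * Real.cos b) ^ 2 + (Real.sinh a * Real.sin b) ^ 2 := by
    refine lt_of_le_of_ne (by positivity) fun h0 => hch ?_
    have h1 : Real.cosh a * Real.cos b = 0 := by nlinarith
    have h2 : Real.sinh a * Real.sin b = 0 := by nlinarith
    rw [e2, h1, h2]; simp
  rw [charFn, e1, e2] at h
  have hr := congrArg Complex.re h
  have hi := congrArg Complex.im h
  simp only [Complex.add_re, Complex.add_im, Complex.mul_re, Complex.mul_im, Complex.ofReal_re,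
    Complex.ofReal_im, Complex.I_re, Complex.I_im, Complex.re_ofNat, Complex.im_ofNat,
    Complex.zero_re, Complex.zero_im] at hr hi
  have hs2 := Real.sin_sq_add_cos_sq b
  have hh2 := Real.cosh_sq a
  -- The imaginary part of `charFn` times the conjugate of `cosh (κ L)`. The real number `γ` drops
  -- out, and `sinh` times the conjugate of `cosh` is `sinh a cosh a + i sin b cos b`.
  have key : 2 * (κ.re * (Real.sin b * Real.cos b) + κ.im * (Real.sinh a * Real.cosh a)) +
      κ.im * ((Real.cosh a * Real.cos b) ^ 2 + (Real.sinh a * Real.sin b) ^ 2) = 0 := by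
    linear_combination (Real.cosh a * Real.cos b) * hi - (Real.sinh a * Real.sin b) * hr -
      2 * κ.im * Real.sinh a * Real.cosh a * hs2 - 2 * κ.re * Real.sin b * Real.cos b * hh2
  have hpos : 0 < a := mul_pos hκ hL
  have b1 : a ≤ Real.sinh a * Real.cosh a := by
    have := Real.self_le_sinh_iff.2 hpos.le
    nlinarith [Real.one_le_cosh a]
  have b2 : -(b ^ 2) ≤ b * (Real.sin b * Real.cos b) := by
    have h1 : |b * (Real.sin b * Real.cos b)| ≤ b ^ 2 := by
      rw [abs_mul b, abs_mul (Real.sin b), ← sq_abs b, sq]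
      refine mul_le_mul_of_nonneg_left ?_ (abs_nonneg b)
      calc _ ≤ |b| * 1 := mul_le_mul Real.abs_sin_le_abs (Real.abs_cos_le_one b)
            (abs_nonneg _) (abs_nonneg _)
        _ = |b| := mul_one _
    exact (abs_le.1 h1).1
  -- Since `a = L re κ` and `b = L im κ`, the bounds `b1` and `b2` both produce `L (re κ) (im κ)²`,
  -- with opposite signs. Then `key` times `im κ` is a sum of nonnegative terms, so `im κ` vanishes.
  have c1 : 0 ≤ κ.im * (κ.re * (Real.sin b * Real.cos b) + κ.im * (Real.sinh a * Real.cosh a)) := by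
    have h1 : κ.im ^ 2 * a ≤ κ.im ^ 2 * (Real.sinh a * Real.cosh a) :=
      mul_le_mul_of_nonneg_left b1 (sq_nonneg _)
    have h2 : -(κ.re * κ.im ^ 2 * L) ≤ κ.re * (κ.im * (Real.sin b * Real.cos b)) := by
      have := mul_le_mul_of_nonneg_left b2 hκ.le
      have h3 : L * -(κ.re * κ.im ^ 2 * L) ≤
          L * (κ.re * (κ.im * (Real.sin b * Real.cos b))) := by
        calc _ = κ.re * -(b ^ 2) := by rw [hb]; ring
          _ ≤ _ := this
          _ = _ := by nth_rw 1 [hb]; ring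
      exact le_of_mul_le_mul_left h3 hL
    rw [ha] at h1
    nlinarith
  have c2 : κ.im ^ 2 * ((Real.cosh a * Real.cos b) ^ 2 + (Real.sinh a * Real.sin b) ^ 2) ≤ 0 := by
    have : κ.im ^ 2 * ((Real.cosh a * Real.cos b) ^ 2 + (Real.sinh a * Real.sin b) ^ 2) =
        -(2 * (κ.im * (κ.re * (Real.sin b * Real.cos b) +
          κ.im * (Real.sinh a * Real.cosh a)))) := by
      linear_combination κ.im * key
    rw [this]; linarith
  have c3 : κ.im ^ 2 ≤ 0 := by
    by_contra hcon
    exact absurd c2 (not_le.2 (mul_pos (not_le.1 hcon) hN))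
  exact pow_eq_zero_iff two_ne_zero |>.1 (le_antisymm c3 (sq_nonneg _))

/-! ### The dispersion relation on the real axis -/

lemma charFn_ofReal_eq_zero_iff {k : ℝ} :
    charFn L γ k = 0 ↔ k * (2 * Real.tanh (k * L) + 1) = -γ := by
  have e : charFn L γ k =
      ((2 * k * Real.sinh (k * L) + (γ + k) * Real.cosh (k * L) : ℝ) : ℂ) := by
    rw [charFn]; push_cast; ring
  have hc := Real.cosh_pos (k * L)
  rw [e, Complex.ofReal_eq_zero, Real.tanh_eq_sinh_div_cosh]
  constructor
  · intro h
    field_simp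
    linear_combination h
  · intro h
    field_simp at h
    linear_combination h

/-- After clearing denominators this is `0 ≤ sinh (y - x)`. -/
lemma tanh_le_tanh {x y : ℝ} (h : x ≤ y) : Real.tanh x ≤ Real.tanh y := by
  rw [Real.tanh_eq_sinh_div_cosh, Real.tanh_eq_sinh_div_cosh,
    div_le_div_iff₀ (Real.cosh_pos _) (Real.cosh_pos _)]
  have := Real.sinh_nonneg_iff.2 (sub_nonneg.2 h)
  rw [Real.sinh_sub] at this
  linarith

lemma tanh_mul_nonneg (hL : 0 < L) {k : ℝ} (hk : 0 ≤ k) : 0 ≤ Real.tanh (k * L) := by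
  have := tanh_le_tanh (mul_nonneg hk hL.le)
  rwa [Real.tanh_zero] at this

/-- The dispersion relation is strictly increasing. -/
lemma dispersion_strictMono (hL : 0 < L) {k l : ℝ} (hk : 0 ≤ k) (h : k < l) :
    k * (2 * Real.tanh (k * L) + 1) < l * (2 * Real.tanh (l * L) + 1) := by
  have h1 := tanh_le_tanh (mul_le_mul_of_nonneg_right h.le hL.le)
  have h2 := tanh_mul_nonneg hL hk
  refine mul_lt_mul h (by linarith) (by linarith) (by linarith)

lemma dispersion_injective (hL : 0 < L) {k l : ℝ} (hk : 0 ≤ k) (hl : 0 ≤ l)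
    (h : k * (2 * Real.tanh (k * L) + 1) = l * (2 * Real.tanh (l * L) + 1)) : k = l := by
  rcases lt_trichotomy k l with hkl | hkl | hkl
  · exact absurd h (dispersion_strictMono hL hk hkl).ne
  · exact hkl
  · exact absurd h (dispersion_strictMono hL hl hkl).ne'

lemma exists_dispersion_eq (hL : 0 < L) (hγ : γ < 0) :
    ∃ k : ℝ, 0 < k ∧ k * (2 * Real.tanh (k * L) + 1) = -γ := by
  have hcont : Continuous fun k : ℝ => k * (2 * Real.tanh (k * L) + 1) := by
    simp only [Real.tanh_eq_sinh_div_cosh]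
    have h1 : Continuous fun k : ℝ => Real.sinh (k * L) / Real.cosh (k * L) :=
      (Real.continuous_sinh.comp (continuous_id.mul continuous_const)).div
        (Real.continuous_cosh.comp (continuous_id.mul continuous_const))
        fun k => (Real.cosh_pos _).ne'
    exact continuous_id.mul ((continuous_const.mul h1).add continuous_const)
  -- The upper endpoint `k = -γ` suffices because the factor `2 tanh + 1` is at least one.
  have hmem : -γ ∈ Icc ((0 : ℝ) * (2 * Real.tanh (0 * L) + 1))
      (-γ * (2 * Real.tanh (-γ * L) + 1)) := by
    have := tanh_mul_nonneg hL (neg_pos.2 hγ).le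
    constructor
    · rw [zero_mul]; linarith
    · nlinarith
  obtain ⟨k, hk, e⟩ := intermediate_value_Icc (neg_pos.2 hγ).le hcont.continuousOn hmem
  refine ⟨k, lt_of_le_of_ne hk.1 fun h0 => ?_, e⟩
  subst h0
  simp only [zero_mul] at e
  linarith

/-- A purely imaginary square root of `-z` would make `z` a nonnegative real; otherwise one of the
two roots has positive real part. -/
lemma exists_sqrt_neg {z : ℂ} (hz : z ∉ (fun x : ℝ => (x : ℂ)) '' Ici 0) :
    ∃ κ : ℂ, 0 < κ.re ∧ z = -κ ^ 2 := by
  obtain ⟨w, hw⟩ := IsAlgClosed.exists_pow_nat_eq (-z) (n := 2) (by norm_num)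
  have hre : w.re ≠ 0 := by
    intro h
    refine hz ⟨w.im ^ 2, mem_Ici.2 (sq_nonneg _), ?_⟩
    have : w = w.im * Complex.I := by apply Complex.ext <;> simp [h]
    have hzz : z = -w ^ 2 := by rw [hw]; ring
    rw [hzz]
    conv_rhs => rw [this]
    push_cast
    linear_combination (w.im : ℂ) ^ 2 * Complex.I_sq
  rcases lt_or_gt_of_ne hre with h | h
  · exact ⟨-w, by simpa using h, by rw [neg_sq, hw, neg_neg]⟩
  · exact ⟨w, h, by rw [hw, neg_neg]⟩

/-! ### Location of the spectrum -/

lemma ofReal_mem_spectrum {x : ℝ} (hx : 0 ≤ x) : (x : ℂ) ∈ spectrum (deltaLaplacian L γ) := by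
  have := sq_mem_spectrum (L := L) (γ := γ) (Real.sqrt_nonneg x)
  rwa [Real.sq_sqrt hx] at this

/-- Only isolation fails: embedded eigenvalues do occur, for instance with eigenfunction `sin (n π x
/ L)` on the loop and zero on the tail. -/
lemma ofReal_notMem_discreteSpectrum {x : ℝ} (hx : 0 ≤ x) :
    (x : ℂ) ∉ discreteSpectrum (deltaLaplacian L γ) := by
  rintro ⟨⟨ε, hε, h⟩, -⟩
  have hm : ((x + ε / 2 : ℝ) : ℂ) ∈
      spectrum (deltaLaplacian L γ) ∩ Metric.ball (x : ℂ) ε := by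
    refine ⟨ofReal_mem_spectrum (by positivity), ?_⟩
    rw [Metric.mem_ball, dist_eq_norm, ← Complex.ofReal_sub, Complex.norm_real, Real.norm_eq_abs,
      add_sub_cancel_left, abs_of_pos (by positivity)]
    linarith
  rw [h, mem_singleton_iff, Complex.ofReal_inj] at hm
  linarith

/-- Points of the spectrum off the half-line are negative and solve the dispersion relation. -/
lemma exists_of_mem_spectrum (hL : 0 < L) {z : ℂ} (hz : z ∈ spectrum (deltaLaplacian L γ))
    (hz' : z ∉ (fun x : ℝ => (x : ℂ)) '' Ici 0) :
    ∃ k : ℝ, 0 < k ∧ z = ((-k ^ 2 : ℝ) : ℂ) ∧ k * (2 * Real.tanh (k * L) + 1) = -γ := by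
  obtain ⟨κ, hκ, rfl⟩ := exists_sqrt_neg hz'
  have hD : charFn L γ κ = 0 := by
    by_contra hD
    exact hz (neg_sq_mem_resolventSet hL hκ hD)
  have him := im_eq_zero_of_charFn_eq_zero hL hκ hD
  have hreal : κ = (κ.re : ℂ) := by apply Complex.ext <;> simp [him]
  rw [hreal] at hD
  refine ⟨κ.re, hκ, ?_, charFn_ofReal_eq_zero_iff.1 hD⟩
  conv_lhs => rw [hreal]
  push_cast; ring

lemma discreteSpectrum_subset_spectrum {E : Type*} [NormedAddCommGroup E]
    [InnerProductSpace ℂ E] (T : E →ₗ.[ℂ] E) : discreteSpectrum T ⊆ spectrum T :=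
  fun _ hz => mem_spectrum_of_eigenspace_ne_bot hz.2.1

lemma mem_discreteSpectrum (hL : 0 < L) {k : ℝ} (hk : 0 < k)
    (h : k * (2 * Real.tanh (k * L) + 1) = -γ) :
    ((-k ^ 2 : ℝ) : ℂ) ∈ discreteSpectrum (deltaLaplacian L γ) := by
  have hD : charFn L γ k = 0 := charFn_ofReal_eq_zero_iff.2 h
  have e : ((-k ^ 2 : ℝ) : ℂ) = -(k : ℂ) ^ 2 := by push_cast; ring
  have heig := eigenspace_neg_sq (γ := γ) hL (κ := (k : ℂ)) (by simpa using hk) hD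
  rw [← e] at heig
  have hk2 : 0 < k ^ 2 := by positivity
  -- The ball of radius `k²` about `-k²` misses `[0, ∞)`, and off that half-line the dispersion
  -- relation leaves no other spectral point.
  refine ⟨⟨k ^ 2, hk2, ?_⟩, heig⟩
  refine Subset.antisymm ?_ ?_
  · rintro z ⟨hz, hzb⟩
    have hz' : z ∉ (fun x : ℝ => (x : ℂ)) '' Ici 0 := by
      rintro ⟨x, hx, rfl⟩
      rw [Metric.mem_ball, dist_eq_norm, ← Complex.ofReal_sub, Complex.norm_real,
        Real.norm_eq_abs, abs_lt] at hzb
      linarith [hzb.2, mem_Ici.1 hx]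
    obtain ⟨l, hl, rfl, hl'⟩ := exists_of_mem_spectrum hL hz hz'
    rw [dispersion_injective hL hl.le hk.le (hl'.trans h.symm)]; rfl
  · rintro _ rfl
    exact ⟨mem_spectrum_of_eigenspace_ne_bot heig.1, Metric.mem_ball_self hk2⟩

end Tadpole

end

theorem proposition2p1 (L : ℝ) (hL : 0 < L) (γ : ℝ) :
    Tadpole.essentialSpectrum (Tadpole.deltaLaplacian L γ) =
        (fun x : ℝ => (x : ℂ)) '' Set.Ici 0 ∧
      (0 ≤ γ → Tadpole.discreteSpectrum (Tadpole.deltaLaplacian L γ) = ∅) ∧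
      (γ < 0 → ∃ lam : ℝ,
        (lam < 0 ∧ -√|lam| * (2 * Real.tanh (√|lam| * L) + 1) = γ) ∧
        (∀ μ : ℝ, μ < 0 → -√|μ| * (2 * Real.tanh (√|μ| * L) + 1) = γ → μ = lam) ∧
        Tadpole.discreteSpectrum (Tadpole.deltaLaplacian L γ) = {(lam : ℂ)}) := by
  have hdisc : ∀ z ∈ Tadpole.discreteSpectrum (Tadpole.deltaLaplacian L γ),
      ∃ k : ℝ, 0 < k ∧ z = ((-k ^ 2 : ℝ) : ℂ) ∧ k * (2 * Real.tanh (k * L) + 1) = -γ := by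
    intro z hz
    refine Tadpole.exists_of_mem_spectrum hL (Tadpole.discreteSpectrum_subset_spectrum _ hz) ?_
    rintro ⟨x, hx, rfl⟩
    exact Tadpole.ofReal_notMem_discreteSpectrum hx hz
  refine ⟨?_, fun hγ => ?_, fun hγ => ?_⟩
  · refine Set.Subset.antisymm ?_ ?_
    · rintro z ⟨hz, hzd⟩
      by_contra hz'
      obtain ⟨k, hk, rfl, h⟩ := Tadpole.exists_of_mem_spectrum hL hz hz'
      exact hzd (Tadpole.mem_discreteSpectrum hL hk h)
    · rintro _ ⟨x, hx, rfl⟩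
      exact ⟨Tadpole.ofReal_mem_spectrum hx, Tadpole.ofReal_notMem_discreteSpectrum hx⟩
  · refine Set.eq_empty_of_forall_notMem fun z hz => ?_
    obtain ⟨k, hk, -, h⟩ := hdisc z hz
    have := Tadpole.tanh_mul_nonneg hL hk.le
    have : 0 < k * (2 * Real.tanh (k * L) + 1) := by positivity
    linarith
  · obtain ⟨k, hk, h⟩ := Tadpole.exists_dispersion_eq hL hγ
    have huniq : ∀ l : ℝ, 0 < l → l * (2 * Real.tanh (l * L) + 1) = -γ → l = k :=
      fun l hl hl' => Tadpole.dispersion_injective hL hl.le hk.le (hl'.trans h.symm)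
    have hsqrt : √|-k ^ 2| = k := by
      rw [abs_neg, abs_of_pos (by positivity), Real.sqrt_sq hk.le]
    refine ⟨-k ^ 2, ⟨neg_lt_zero.2 (by positivity), ?_⟩, fun μ hμ hμ' => ?_, ?_⟩
    · rw [hsqrt]; linarith
    · have h1 := huniq √|μ| (Real.sqrt_pos.2 (abs_pos.2 hμ.ne)) (by linarith)
      rw [← h1, Real.sq_sqrt (abs_nonneg μ), abs_of_neg hμ, neg_neg]
    · refine Set.Subset.antisymm ?_ ?_
      · intro z hz
        obtain ⟨l, hl, rfl, hl'⟩ := hdisc z hz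
        rw [huniq l hl hl']; rfl
      · rintro _ rfl
        exact Tadpole.mem_discreteSpectrum hL hk h
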